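/- **Definitions.** All manifolds are smooth, finite-dimensional and without boundary; a semi-Riemannian metric is a smooth symmetric $(0,2)$-tensor field that is non-degenerate at every point. Let $M$ be a manifold of dimension $n$ with a *singular semi-Riemannian metric* $g=\langle\cdot,\cdot\rangle$, i.e. a smooth symmetric $(0,2)$-tensor field, possibly degenerate and of possibly varying signature. Let $\flat:T_pM\to T_p^*M$, $X^\flat(Y)=\langle X,Y\rangle$; on $\flat(T_pM)$ there is the inner product $g_\bullet(X^\flat,Y^\flat)=\langle X,Y\rangle$, and contraction of covariant slots is taken with $g_\bullet$. The Koszul form of local smooth vector fields is $$\mathcal K(X,Y,Z)=\tfrac12\{X\langle Y,Z\rangle+Y\langle Z,X\rangle-Z\langle X,Y\rangle-\langle X,[Y,Z]\rangle+\langle Y,[Z,X]\rangle+\langle Z,[X,Y]\rangle\}.$$ * $g$ is *semi-regular* if for all local smooth vector fields $X,Y,Z,T$ on an open set $U\subseteq M$, $\mathcal K(X,Y,\_)\in\flat(T_pM)$ at every $p\in U$, and the contraction $\mathcal K(X,Y,\bullet)\,\mathcal K(Z,T,\bullet)$, on the points of $U$ near which the signature of $g$ is constant, extends to a smooth function on $U$.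 (If $g$ is non-degenerate on a dense set, these points are exactly the points of $U$ at which $g$ is non-degenerate.) * In local coordinates put $\Gamma_{abc}=\mathcal K(\partial_a,\partial_b,\partial_c)$ and, at the points where $g$ is non-degenerate, $$R_{abcd}=\partial_a\Gamma_{bcd}-\partial_b\Gamma_{acd}+\Gamma_{ac\bullet}\Gamma_{bd\bullet}-\Gamma_{bc\bullet}\Gamma_{ad\bullet},\quad R_{ab}=g^{st}R_{asbt},\quad R=g^{st}R_{st},\quad S_{ab}=R_{ab}-\tfrac1nRg_{ab},$$ $$S_{abcd}=\tfrac{1}{2n(n-1)}R\,(g\circ g)_{abcd},\qquad E_{abcd}=\tfrac1{n-2}(S\circ g)_{abcd},$$ where $(h\circ k)_{abcd}=h_{ac}k_{bd}-h_{ad}k_{bc}+h_{bd}k_{ac}-h_{bc}k_{ad}$ is the Kulkarni–Nomizu product, and by convention $S_{abcd}=0$ if $n=1$ and $E_{abcd}=0$ if $n=2$ (where $g\circ g=0$, respectively $S_{ab}=0$). * $g$ is *quasi-regular* if it is semi-regular, it is non-degenerate on a dense subset of $M$, and the tensors $S_{abcd}$ and $E_{abcd}$, defined at the points where $g$ is non-degenerate,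 extend to smooth tensor fields on all of $M$. **Theorem.** Let $(B,ds_B^2)$ and $(F,ds_F^2)$ be semi-Riemannian manifolds with $\dim B=1$, and let $f:B\to\mathbb R$ be a smooth function (which may vanish at some points) such that $\{f\neq0\}$ is dense in $B$. Then the degenerate warped product $B\times_fF$, that is, the manifold $B\times F$ with the metric $ds_B^2+f^2ds_F^2$, is quasi-regular. -/

import Mathlib

open scoped Manifold ContDiff Topology

noncomputable section

namespace SingularSemiRiemannian

section Manifold

variable {E : Type*} [NormedAddCommGroup E] [NormedSpace ℝ E]
  {H : Type*} [TopologicalSpace H] (I : ModelWithCorners ℝ E H)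
  {M : Type*} [TopologicalSpace M] [ChartedSpace H M] [IsManifold I ∞ M]

/-- The vector field `X` is smooth on the set `U`. -/
def IsSmoothVectorFieldOn (X : ∀ p : M, TangentSpace I p) (U : Set M) : Prop :=
  ContMDiffOn I I.tangent ∞ (fun p => (⟨p, X p⟩ : TangentBundle I M)) U

variable (M) in
/-- A field of bilinear forms on the tangent spaces of `M`, without any regularity. -/
abbrev BilinField : Type _ := ∀ p : M, LinearMap.BilinForm ℝ (TangentSpace I p)

variable (M) in
/-- A field of covariant tensors of order four on `M`, without any regularity. -/
abbrev TensorField₄ : Type _ :=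
  ∀ p : M, MultilinearMap ℝ (fun _ : Fin 4 => TangentSpace I p) ℝ

variable {I}

/-- A tensor field of type `(0,4)` is smooth: it is smooth on all smooth local vector fields. -/
def TensorField₄.IsSmooth (T : TensorField₄ I M) : Prop :=
  ∀ U : Set M, IsOpen U → ∀ X Y Z W : ∀ p : M, TangentSpace I p,
    IsSmoothVectorFieldOn I X U → IsSmoothVectorFieldOn I Y U →
    IsSmoothVectorFieldOn I Z U → IsSmoothVectorFieldOn I W U →
    ContMDiffOn I 𝓘(ℝ) ∞ (fun p => T p ![X p, Y p, Z p, W p]) U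

/-- `g` is the metric of a singular semi-Riemannian manifold: a smooth symmetric tensor field of
type `(0,2)`, possibly degenerate, of arbitrary and possibly varying signature. -/
structure IsSingularMetric (g : BilinField I M) : Prop where
  symm : ∀ p : M, ∀ v w : TangentSpace I p, g p v w = g p w v
  smooth : ∀ U : Set M, IsOpen U → ∀ X Y : ∀ p : M, TangentSpace I p,
    IsSmoothVectorFieldOn I X U → IsSmoothVectorFieldOn I Y U →
    ContMDiffOn I 𝓘(ℝ) ∞ (fun p => g p (X p) (Y p)) U

/-- `g` is a semi-Riemannian metric: a smooth symmetric tensor field of type `(0,2)` which is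
non-degenerate at every point. -/
structure IsSemiRiemannianMetric (g : BilinField I M) : Prop extends IsSingularMetric g where
  nondegenerate : ∀ p : M, (g p).Nondegenerate

/-! ### Koszul form and contraction -/

variable (I) in
/-- The derivative `X h` of a function `h` along a vector field `X`. -/
def derivAlong (X : ∀ p : M, TangentSpace I p) (h : M → ℝ) (p : M) : ℝ :=
  NormedSpace.fromTangentSpace (h p) (mfderiv I 𝓘(ℝ) h p (X p))

/-- The Koszul form `𝒦(X, Y, Z)`. -/
def koszul (g : BilinField I M) (X Y Z : ∀ p : M, TangentSpace I p) (p : M) : ℝ :=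
  (1 / 2) * (derivAlong I X (fun q => g q (Y q) (Z q)) p
    + derivAlong I Y (fun q => g q (Z q) (X q)) p
    - derivAlong I Z (fun q => g q (X q) (Y q)) p
    - g p (X p) (VectorField.mlieBracket I Y Z p)
    + g p (Y p) (VectorField.mlieBracket I Z X p)
    + g p (Z p) (VectorField.mlieBracket I X Y p))

/-- The tangent vector `w` at `p` satisfies `w♭ = 𝒦(X, Y, _)` in the cotangent space at `p`. -/
def RepresentsKoszul (g : BilinField I M) (X Y : ∀ p : M, TangentSpace I p) (p : M)
    (w : TangentSpace I p) : Prop :=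
  ∀ U : Set M, IsOpen U → p ∈ U → ∀ Z : ∀ q : M, TangentSpace I q,
    IsSmoothVectorFieldOn I Z U → koszul g X Y Z p = g p w (Z p)

open Classical in
/-- A vector `w` with `w♭ = 𝒦(X, Y, _)` at `p`, if there is one (and `0` otherwise). It is unique
up to the kernel of `♭`; where the metric is non-degenerate, it is `∇_X Y`. -/
def koszulSharp (g : BilinField I M) (X Y : ∀ p : M, TangentSpace I p) (p : M) :
    TangentSpace I p :=
  if h : ∃ w, RepresentsKoszul g X Y p w then h.choose else 0

/-- The contraction `𝒦(X, Y, •) 𝒦(Z, T, •)` at `p`, that is, the inner product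
`g_•(u♭, w♭) = ⟨u, w⟩` on `♭(T_p M)` of the covectors `u♭ = 𝒦(X, Y, _)` and
`w♭ = 𝒦(Z, T, _)`. It does not depend on the choice of `u` and `w`. -/
def koszulContraction (g : BilinField I M) (X Y Z T : ∀ p : M, TangentSpace I p) (p : M) : ℝ :=
  g p (koszulSharp g X Y p) (koszulSharp g Z T p)

/-- The metric has constant rank (hence, by continuity, constant signature) near `p`. These points
form an open dense set. If the points at which the metric is non-degenerate are dense, these
points are exactly the points at which it is non-degenerate. -/
def IsSignatureRegularPoint (g : BilinField I M) (p : M) : Prop :=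
  ∀ᶠ q in 𝓝 p, Module.finrank ℝ (LinearMap.range (g q)) = Module.finrank ℝ (LinearMap.range (g p))

/-- Semi-regular metric: `𝒦(X, Y, _)` belongs to `♭(T_p M)` at every point `p`, and the
contraction `𝒦(X, Y, •) 𝒦(Z, T, •)` is smooth for all smooth local vector fields. The inner product
`g_•` jumps where the signature of the metric changes, so smoothness of the contraction means that
its values on the open dense set where the signature is locally constant
extend to a smooth function. -/
structure IsSemiRegular (g : BilinField I M) : Prop extends IsSingularMetric g where
  koszul_mem_flat : ∀ U : Set M, IsOpen U → ∀ X Y : ∀ p : M, TangentSpace I p,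
    IsSmoothVectorFieldOn I X U → IsSmoothVectorFieldOn I Y U →
    ∀ p ∈ U, ∃ w : TangentSpace I p, RepresentsKoszul g X Y p w
  contraction_smooth : ∀ U : Set M, IsOpen U → ∀ X Y Z T : ∀ p : M, TangentSpace I p,
    IsSmoothVectorFieldOn I X U → IsSmoothVectorFieldOn I Y U →
    IsSmoothVectorFieldOn I Z U → IsSmoothVectorFieldOn I T U →
    ∃ φ : M → ℝ, ContMDiffOn I 𝓘(ℝ) ∞ φ U ∧
      ∀ p ∈ U, IsSignatureRegularPoint g p → φ p = koszulContraction g X Y Z T p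

/-! ### Curvature in coordinates

A coordinate system is given by a chart `e` and a basis `b` of the model space: the coordinates of
a point are the components of its image under the chart. -/

section Coordinates

variable {ι : Type*}

/-- The Kulkarni-Nomizu product `h ∘ k` of two bilinear forms, in components. -/
def kulkarniNomizu (h k : ι → ι → ℝ) (a b c d : ι) : ℝ :=
  h a c * k b d - h a d * k b c + h b d * k a c - h b c * k a d

variable (I) in
/-- The coordinate vector field `∂_a`. It is only meaningful on the domain of the chart. -/
def coordField (e : OpenPartialHomeomorph M H) (b : Module.Basis ι ℝ E) (a : ι) :
    ∀ p : M, TangentSpace I p :=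
  VectorField.mpullback I 𝓘(ℝ, E) (e.extend I)
    (fun x => (NormedSpace.fromTangentSpace x).symm (b a))

variable (g : BilinField I M) (e : OpenPartialHomeomorph M H) (b : Module.Basis ι ℝ E)

/-- The components `g_{ij}` of the metric. -/
def metricComp (p : M) (i j : ι) : ℝ :=
  g p (coordField I e b i p) (coordField I e b j p)

/-- The Riemann curvature
`R_{ijkl} = ∂_i Γ_{jkl} - ∂_j Γ_{ikl} + Γ_{ik•} Γ_{jl•} - Γ_{jk•} Γ_{il•}`, where
`Γ_{ijk} = 𝒦(∂_i, ∂_j, ∂_k)`. -/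
def riemann (p : M) (i j k l : ι) : ℝ :=
  derivAlong I (coordField I e b i)
      (koszul g (coordField I e b j) (coordField I e b k) (coordField I e b l)) p
    - derivAlong I (coordField I e b j)
      (koszul g (coordField I e b i) (coordField I e b k) (coordField I e b l)) p
    + koszulContraction g (coordField I e b i) (coordField I e b k)
      (coordField I e b j) (coordField I e b l) p
    - koszulContraction g (coordField I e b j) (coordField I e b k)
      (coordField I e b i) (coordField I e b l) p

variable [Fintype ι] [DecidableEq ι] (p : M)

/-- The components `g^{st}` of the inverse metric (only meaningful where `g` is non-degenerate). -/
def inverseMetricComp (s t : ι) : ℝ :=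
  (Matrix.of (metricComp g e b p))⁻¹ s t

/-- The Ricci curvature `R_{ij} = g^{st} R_{isjt}`. -/
def ricci (i j : ι) : ℝ :=
  ∑ s, ∑ t, inverseMetricComp g e b p s t * riemann g e b p i s j t

/-- The scalar curvature `R = g^{st} R_{st}`. -/
def scalarCurvature : ℝ :=
  ∑ s, ∑ t, inverseMetricComp g e b p s t * ricci g e b p s t

/-- The traceless part of the Ricci curvature, `S_{ij} = R_{ij} - (1/n) R g_{ij}`. -/
def tracelessRicci (i j : ι) : ℝ :=
  ricci g e b p i j - 1 / (Fintype.card ι : ℝ) * scalarCurvature g e b p * metricComp g e b p i j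

/-- The scalar part `S_{ijkl} = 1/(2n(n-1)) R (g ∘ g)_{ijkl}` of the Riemann curvature.
For `n = 1` it is `0` (and then `g ∘ g = 0`). -/
def scalarPart (i j k l : ι) : ℝ :=
  1 / (2 * (Fintype.card ι : ℝ) * ((Fintype.card ι : ℝ) - 1)) * scalarCurvature g e b p
    * kulkarniNomizu (metricComp g e b p) (metricComp g e b p) i j k l

/-- The semi-traceless part `E_{ijkl} = 1/(n-2) (S ∘ g)_{ijkl}` of the Riemann curvature.
For `n = 2` it is `0` (and then `S_{ij} = 0`). -/
def semiTracelessPart (i j k l : ι) : ℝ :=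
  1 / ((Fintype.card ι : ℝ) - 2)
    * kulkarniNomizu (tracelessRicci g e b p) (metricComp g e b p) i j k l

end Coordinates

/-- The smooth tensor field `T` on all of `M` extends the tensor with components `C e b p i j k l`
in every coordinate system, defined at the points `p` where the metric `g` is non-degenerate. -/
def IsSmoothExtension (g : BilinField I M)
    (C : OpenPartialHomeomorph M H → Module.Basis (Fin (Module.finrank ℝ E)) ℝ E → M →
      Fin (Module.finrank ℝ E) → Fin (Module.finrank ℝ E) →
      Fin (Module.finrank ℝ E) → Fin (Module.finrank ℝ E) → ℝ)
    (T : TensorField₄ I M) : Prop :=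
  T.IsSmooth ∧ ∀ e ∈ IsManifold.maximalAtlas I ∞ M, ∀ b, ∀ p ∈ e.source, (g p).Nondegenerate →
    ∀ i j k l, T p ![coordField I e b i p, coordField I e b j p,
      coordField I e b k p, coordField I e b l p] = C e b p i j k l

/-- Quasi-regular metric: a semi-regular metric, non-degenerate on a dense set, such that the tensors
`S_{abcd}` and `E_{abcd}`, defined at the points where the metric is non-degenerate, extend
smoothly to the entire manifold. -/
structure IsQuasiRegular [FiniteDimensional ℝ E] (g : BilinField I M) : Prop
    extends IsSemiRegular g where
  dense_nondegenerate : Dense {p : M | (g p).Nondegenerate}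
  scalarPart_extends : ∃ T : TensorField₄ I M, IsSmoothExtension g (fun e b p => scalarPart g e b p) T
  semiTracelessPart_extends : ∃ T : TensorField₄ I M, IsSmoothExtension g (fun e b p => semiTracelessPart g e b p) T

end Manifold

section WarpedProduct

variable {EB : Type*} [NormedAddCommGroup EB] [NormedSpace ℝ EB]
  {HB : Type*} [TopologicalSpace HB] {IB : ModelWithCorners ℝ EB HB}
  {B : Type*} [TopologicalSpace B] [ChartedSpace HB B] [IsManifold IB ∞ B]
  {EF : Type*} [NormedAddCommGroup EF] [NormedSpace ℝ EF]
  {HF : Type*} [TopologicalSpace HF] {IF : ModelWithCorners ℝ EF HF}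
  {F : Type*} [TopologicalSpace F] [ChartedSpace HF F] [IsManifold IF ∞ F]

/-- The metric `ds_B² + f² ds_F²` on `B × F`, where `ds_B²` and `ds_F²` are pulled back along the
projections and `f` is a function on `B`. -/
def warpedProduct (gB : BilinField IB B) (gF : BilinField IF F) (f : B → ℝ) :
    BilinField (IB.prod IF) (B × F) := fun p =>
  (gB p.1).compl₁₂ (mfderiv (IB.prod IF) IB Prod.fst p).toLinearMap
      (mfderiv (IB.prod IF) IB Prod.fst p).toLinearMap
    + f p.1 ^ 2 • (gF p.2).compl₁₂ (mfderiv (IB.prod IF) IF Prod.snd p).toLinearMap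
      (mfderiv (IB.prod IF) IF Prod.snd p).toLinearMap

end WarpedProduct

end SingularSemiRiemannian

end

/-!
In local coordinates the metric of `B ×_f F` is `G = β(t) dt² + f(t)² h`, where `β` has no zeros and
`h` is a non-degenerate metric on an open subset of a vector space (`WarpedModel`). The theorem is
local in two ways. The Koszul form and the curvature can be computed in any parametrization of the
manifold (`koszul_param`, `koszulContraction_param`, `riemann_param`), so coordinates adapted to the
product may be used although quasi-regularity refers to all charts. And extensions by continuity
from a dense set are unique, so local smooth extensions glue (`exists_contMDiffOn_of_local`,
`exists_isSmoothExtension_of_local`). What remains is a computation with `G`.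

*Semi-regularity.* The Christoffel symbols of the first kind of `G` are
`½ β' dt³ + f² Γ^h + f f' (…)`. Where `f = 0` all terms but the first vanish, so the last index can
be raised at every point (`WarpedModel.isChristoffelSharp_sharp`). The fibre component of the
result has the singular coefficient `f' / f`, but in a contraction it is paired by `f² h`, which
leaves `f'²` and `f f'` (`WarpedModel.contraction`).

*Curvature.* The Riemann tensor of `G` is `f² A + f H (dt² ∘ h)` with a smooth vertical tensor `A`
and the Hessian `H` of `f` along the base (`WarpedModel.flatRiemann_metric`). Hence, for a fibre of
dimension `m`, the Ricci tensor is `(m H / f) dt²` plus a smooth vertical form, and the scalar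
curvature is `ρ / f²` with `ρ` smooth. Both are singular where `f = 0`. The Kulkarni-Nomizu products
are not: as the base is one-dimensional, `dt² ∘ dt² = 0`. So every term of `g ∘ g` has a factor
`f²`, which cancels the pole of `R`. And in `S ∘ g` the coefficient of `dt²` in `S`, which has order
`f⁻²`, only meets the part `f² h` of `g`, while the vertical part of `S` is smooth
(`WarpedModel.scalarPart_model`, `WarpedModel.semiTracelessPart_model`).

These formulas hold where `f ≠ 0`. A warped product is degenerate elsewhere unless the fibre has
dimension zero, and in that case `f` may be replaced by `1` without changing the metric.
-/

-- The value with which Mathlib itself is compiled.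
set_option maxSynthPendingDepth 3
set_option linter.unusedSectionVars false

noncomputable section

namespace SingularSemiRiemannian

/-! ### Metrics on open subsets of a vector space -/

section Flat

variable {W : Type*} [NormedAddCommGroup W] [NormedSpace ℝ W]

/-- The Christoffel symbol of the first kind `Γ(u, v, w)` at `y` of a metric `G` on a vector space,
that is, the Koszul form of the constant vector fields `u`, `v`, `w`. -/
def christoffel (G : W → W →L[ℝ] W →L[ℝ] ℝ) (y u v w : W) : ℝ :=
  (1 / 2) * (fderiv ℝ G y u v w + fderiv ℝ G y v w u - fderiv ℝ G y w u v)

/-- The map `S` raises the last index of the Christoffel symbols of `G` at `y`. If `G` is degenerate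
at `y`, such an `S` need not exist, and it is not unique. -/
def IsChristoffelSharp (G : W → W →L[ℝ] W →L[ℝ] ℝ) (S : W → W → W → W) (y : W) : Prop :=
  ∀ u v w, G y (S y u v) w = christoffel G y u v w

/-- The curvature tensor of a metric `G` on a vector space, on the constant vector fields
`u`, `v`, `z`, `t`. The contractions are expressed through a map `S` that raises the last index of
the Christoffel symbols. -/
def flatRiemann (G : W → W →L[ℝ] W →L[ℝ] ℝ) (S : W → W → W → W) (y u v z t : W) : ℝ :=
  fderiv ℝ (fun x => christoffel G x v z t) y u - fderiv ℝ (fun x => christoffel G x u z t) y v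
    + G y (S y u z) (S y v t) - G y (S y v z) (S y u t)

variable {G : W → W →L[ℝ] W →L[ℝ] ℝ} {y : W}

lemma fderiv_symm_of_symm (hsymm : ∀ᶠ x in 𝓝 y, ∀ v w, G x v w = G x w v)
    (hG : DifferentiableAt ℝ G y) (u v w : W) :
    fderiv ℝ G y u v w = fderiv ℝ G y u w v := by
  have key : ∀ v w : W, fderiv ℝ (fun x => G x v w) y u = fderiv ℝ G y u v w := by
    intro v w
    have h := ((hG.hasFDerivAt.clm_apply (hasFDerivAt_const v y)).clm_apply
      (hasFDerivAt_const w y))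
    rw [h.fderiv]
    simp
  rw [← key, ← key]
  have : (fun x => G x v w) =ᶠ[𝓝 y] fun x => G x w v := hsymm.mono fun x hx => hx v w
  rw [this.fderiv_eq]

lemma fderiv_metric_apply (hG : DifferentiableAt ℝ G y) {X Y : W → W}
    (hX : DifferentiableAt ℝ X y) (hY : DifferentiableAt ℝ Y y) (u : W) :
    fderiv ℝ (fun x => G x (X x) (Y x)) y u =
      fderiv ℝ G y u (X y) (Y y) + G y (fderiv ℝ X y u) (Y y) + G y (X y) (fderiv ℝ Y y u) := by
  have h := ((hG.hasFDerivAt.clm_apply hX.hasFDerivAt).clm_apply hY.hasFDerivAt)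
  rw [h.fderiv]
  simp
  ring

/-- In a vector space, `𝒦(X, Y, Z) = ⟨D_X Y, Z⟩ + Γ(X, Y, Z)`. -/
lemma flat_koszul (hsymm : ∀ᶠ x in 𝓝 y, ∀ v w, G x v w = G x w v)
    (hG : DifferentiableAt ℝ G y) {X Y Z : W → W}
    (hX : DifferentiableAt ℝ X y) (hY : DifferentiableAt ℝ Y y) (hZ : DifferentiableAt ℝ Z y) :
    (1 / 2) * (fderiv ℝ (fun x => G x (Y x) (Z x)) y (X y)
      + fderiv ℝ (fun x => G x (Z x) (X x)) y (Y y)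
      - fderiv ℝ (fun x => G x (X x) (Y x)) y (Z y)
      - G y (X y) (VectorField.lieBracket ℝ Y Z y)
      + G y (Y y) (VectorField.lieBracket ℝ Z X y)
      + G y (Z y) (VectorField.lieBracket ℝ X Y y)) =
    G y (fderiv ℝ Y y (X y)) (Z y) + christoffel G y (X y) (Y y) (Z y) := by
  rw [fderiv_metric_apply hG hY hZ, fderiv_metric_apply hG hZ hX,
    fderiv_metric_apply hG hX hY]
  simp only [VectorField.lieBracket_eq, christoffel, map_sub]
  have hs := hsymm.self_of_nhds
  rw [hs (Y y) (fderiv ℝ Z y (X y)), hs (Y y) (fderiv ℝ X y (Z y)),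
    hs (X y) (fderiv ℝ Z y (Y y)), hs (X y) (fderiv ℝ Y y (Z y)), hs (Z y) (fderiv ℝ Y y (X y)),
    hs (Z y) (fderiv ℝ X y (Y y))]
  ring

lemma differentiableAt_fderiv_metric (hG : ContDiffAt ℝ ∞ G y) :
    DifferentiableAt ℝ (fderiv ℝ G) y :=
  (hG.fderiv_right (m := 1) (WithTop.coe_le_coe.2 le_top)).differentiableAt one_ne_zero

lemma fderiv_fderiv_metric_apply (hG : ContDiffAt ℝ ∞ G y) {X Y Z : W → W}
    (hX : DifferentiableAt ℝ X y) (hY : DifferentiableAt ℝ Y y) (hZ : DifferentiableAt ℝ Z y) :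
    DifferentiableAt ℝ (fun x => fderiv ℝ G x (X x) (Y x) (Z x)) y ∧ ∀ u,
    fderiv ℝ (fun x => fderiv ℝ G x (X x) (Y x) (Z x)) y u =
      fderiv ℝ (fderiv ℝ G) y u (X y) (Y y) (Z y) + fderiv ℝ G y (fderiv ℝ X y u) (Y y) (Z y)
      + fderiv ℝ G y (X y) (fderiv ℝ Y y u) (Z y) + fderiv ℝ G y (X y) (Y y) (fderiv ℝ Z y u) := by
  have h := (((differentiableAt_fderiv_metric hG).hasFDerivAt.clm_apply hX.hasFDerivAt).clm_apply
    hY.hasFDerivAt).clm_apply hZ.hasFDerivAt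
  refine ⟨h.differentiableAt, fun u => ?_⟩
  rw [h.fderiv]
  simp
  ring

lemma fderiv_christoffel_apply (hG : ContDiffAt ℝ ∞ G y) {X Y Z : W → W}
    (hX : DifferentiableAt ℝ X y) (hY : DifferentiableAt ℝ Y y) (hZ : DifferentiableAt ℝ Z y) :
    DifferentiableAt ℝ (fun x => christoffel G x (X x) (Y x) (Z x)) y ∧ ∀ u,
    fderiv ℝ (fun x => christoffel G x (X x) (Y x) (Z x)) y u =
      (1 / 2) * (fderiv ℝ (fderiv ℝ G) y u (X y) (Y y) (Z y)
        + fderiv ℝ (fderiv ℝ G) y u (Y y) (Z y) (X y)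
        - fderiv ℝ (fderiv ℝ G) y u (Z y) (X y) (Y y))
      + christoffel G y (fderiv ℝ X y u) (Y y) (Z y)
      + christoffel G y (X y) (fderiv ℝ Y y u) (Z y)
      + christoffel G y (X y) (Y y) (fderiv ℝ Z y u) := by
  obtain ⟨d1, e1⟩ := fderiv_fderiv_metric_apply hG hX hY hZ
  obtain ⟨d2, e2⟩ := fderiv_fderiv_metric_apply hG hY hZ hX
  obtain ⟨d3, e3⟩ := fderiv_fderiv_metric_apply hG hZ hX hY
  refine ⟨((d1.add d2).sub d3).const_mul _, fun u => ?_⟩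
  have h := (((d1.hasFDerivAt.add d2.hasFDerivAt).sub d3.hasFDerivAt).const_mul (1 / 2 : ℝ))
  have h' : fderiv ℝ (fun x => christoffel G x (X x) (Y x) (Z x)) y = _ := h.fderiv
  rw [h']
  simp only [smul_apply, sub_apply,
    add_apply, e1, e2, e3, smul_eq_mul, christoffel]
  ring

lemma fderiv_christoffel_const (hG : ContDiffAt ℝ ∞ G y) (u v w z : W) :
    fderiv ℝ (fun x => christoffel G x v w z) y u =
      (1 / 2) * (fderiv ℝ (fderiv ℝ G) y u v w z + fderiv ℝ (fderiv ℝ G) y u w z v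
        - fderiv ℝ (fderiv ℝ G) y u z v w) := by
  have h := (fderiv_christoffel_apply hG (differentiableAt_const v) (differentiableAt_const w)
    (differentiableAt_const z)).2 u
  rw [h]
  simp [christoffel]

lemma christoffel_symm (hsymm : ∀ᶠ x in 𝓝 y, ∀ v w, G x v w = G x w v)
    (hG : DifferentiableAt ℝ G y) (u v w : W) :
    christoffel G y u v w = christoffel G y v u w := by
  rw [christoffel, christoffel, fderiv_symm_of_symm hsymm hG u v w,
    fderiv_symm_of_symm hsymm hG v w u, fderiv_symm_of_symm hsymm hG w u v]
  ring

lemma christoffel_add_christoffel (hsymm : ∀ᶠ x in 𝓝 y, ∀ v w, G x v w = G x w v)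
    (hG : DifferentiableAt ℝ G y) (u v w : W) :
    christoffel G y u v w + christoffel G y u w v = fderiv ℝ G y u v w := by
  rw [christoffel, christoffel, fderiv_symm_of_symm hsymm hG u w v,
    fderiv_symm_of_symm hsymm hG v u w, fderiv_symm_of_symm hsymm hG w v u]
  ring

lemma differentiableAt_flat_koszul (hG : ContDiffAt ℝ ∞ G y) {Y Z T : W → W}
    (hY : DifferentiableAt ℝ Y y) (hZ : ContDiffAt ℝ ∞ Z y) (hT : DifferentiableAt ℝ T y) :
    DifferentiableAt ℝ
      (fun x => G x (fderiv ℝ Z x (Y x)) (T x) + christoffel G x (Y x) (Z x) (T x)) y := by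
  have dZ' : DifferentiableAt ℝ (fderiv ℝ Z) y :=
    (hZ.fderiv_right (m := 1) (WithTop.coe_le_coe.2 le_top)).differentiableAt one_ne_zero
  exact (((hG.differentiableAt (by simp)).clm_apply (dZ'.clm_apply hY)).clm_apply hT).add
    (fderiv_christoffel_apply hG hY (hZ.differentiableAt (by simp)) hT).1

/-- If `X` and `Y` commute, the expression that defines the Riemann curvature through the Koszul
form is tensorial: the derivatives of the vector fields cancel. -/
lemma flat_riemann_of_commute (hsymm : ∀ᶠ x in 𝓝 y, ∀ v w, G x v w = G x w v)
    (hG : ContDiffAt ℝ ∞ G y) {S : W → W → W → W} (hS : IsChristoffelSharp G S y)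
    {X Y Z T : W → W} (hX : ContDiffAt ℝ ∞ X y) (hY : ContDiffAt ℝ ∞ Y y)
    (hZ : ContDiffAt ℝ ∞ Z y) (hT : ContDiffAt ℝ ∞ T y)
    (hXY : VectorField.lieBracket ℝ X Y y = 0) :
    fderiv ℝ (fun x => G x (fderiv ℝ Z x (Y x)) (T x) + christoffel G x (Y x) (Z x) (T x)) y (X y)
    - fderiv ℝ (fun x => G x (fderiv ℝ Z x (X x)) (T x) + christoffel G x (X x) (Z x) (T x)) y (Y y)
    + G y (fderiv ℝ Z y (X y) + S y (X y) (Z y)) (fderiv ℝ T y (Y y) + S y (Y y) (T y))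
    - G y (fderiv ℝ Z y (Y y) + S y (Y y) (Z y)) (fderiv ℝ T y (X y) + S y (X y) (T y))
    = flatRiemann G S y (X y) (Y y) (Z y) (T y) := by
  have hG1 : DifferentiableAt ℝ G y := hG.differentiableAt (by simp)
  have dX : DifferentiableAt ℝ X y := hX.differentiableAt (by simp)
  have dY : DifferentiableAt ℝ Y y := hY.differentiableAt (by simp)
  have dZ : DifferentiableAt ℝ Z y := hZ.differentiableAt (by simp)
  have dT : DifferentiableAt ℝ T y := hT.differentiableAt (by simp)
  have dZ' : DifferentiableAt ℝ (fderiv ℝ Z) y :=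
    (hZ.fderiv_right (m := 1) (WithTop.coe_le_coe.2 le_top)).differentiableAt one_ne_zero
  have dd : ∀ {V : W → W}, DifferentiableAt ℝ V y →
      DifferentiableAt ℝ (fun x => fderiv ℝ Z x (V x)) y ∧ ∀ u,
        fderiv ℝ (fun x => fderiv ℝ Z x (V x)) y u =
          fderiv ℝ (fderiv ℝ Z) y u (V y) + fderiv ℝ Z y (fderiv ℝ V y u) := by
    intro V hV
    have h := dZ'.hasFDerivAt.clm_apply hV.hasFDerivAt
    refine ⟨h.differentiableAt, fun u => ?_⟩
    rw [h.fderiv]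
    simp [add_comm]
  have key : ∀ {V : W → W}, DifferentiableAt ℝ V y → ∀ u : W,
      fderiv ℝ (fun x => G x (fderiv ℝ Z x (V x)) (T x) + christoffel G x (V x) (Z x) (T x)) y u =
      fderiv ℝ G y u (fderiv ℝ Z y (V y)) (T y)
      + G y (fderiv ℝ (fderiv ℝ Z) y u (V y) + fderiv ℝ Z y (fderiv ℝ V y u)) (T y)
      + G y (fderiv ℝ Z y (V y)) (fderiv ℝ T y u)
      + (fderiv ℝ (fun x => christoffel G x (V y) (Z y) (T y)) y u
        + christoffel G y (fderiv ℝ V y u) (Z y) (T y)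
        + christoffel G y (V y) (fderiv ℝ Z y u) (T y)
        + christoffel G y (V y) (Z y) (fderiv ℝ T y u)) := by
    intro V hV u
    have h1 : DifferentiableAt ℝ (fun x => G x (fderiv ℝ Z x (V x)) (T x)) y :=
      (hG1.clm_apply (dd hV).1).clm_apply dT
    obtain ⟨h2, e2⟩ := fderiv_christoffel_apply hG hV dZ dT
    have e : fderiv ℝ (fun x => G x (fderiv ℝ Z x (V x)) (T x)
        + christoffel G x (V x) (Z x) (T x)) y = _ := fderiv_add h1 h2
    rw [e, add_apply, fderiv_metric_apply hG1 (dd hV).1 dT, (dd hV).2, e2,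
      fderiv_christoffel_const hG]
  have hcomm : fderiv ℝ Y y (X y) = fderiv ℝ X y (Y y) := by
    rw [VectorField.lieBracket_eq] at hXY
    exact sub_eq_zero.1 hXY
  -- The second derivatives of `Z` cancel by symmetry; `hcomm` cancels the first derivatives of `X`
  -- and `Y`.
  have hsecond : fderiv ℝ (fderiv ℝ Z) y (X y) (Y y) = fderiv ℝ (fderiv ℝ Z) y (Y y) (X y) :=
    (hZ.isSymmSndFDerivAt
      (by rw [minSmoothness_of_isRCLikeNormedField]; exact ENat.LEInfty.out)).eq _ _
  have hs := hsymm.self_of_nhds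
  rw [key dY, key dX, hcomm, hsecond,
    ← christoffel_add_christoffel hsymm hG1 (X y), ← christoffel_add_christoffel hsymm hG1 (Y y),
    flatRiemann]
  simp only [map_add, add_apply]
  simp only [hS (X y) (Z y), hS (Y y) (Z y), hs _ (S y (Y y) (T y)), hs _ (S y (X y) (T y)),
    hS (X y) (T y), hS (Y y) (T y)]
  rw [hs (fderiv ℝ Z y (X y)) (fderiv ℝ T y (Y y)), hs (fderiv ℝ Z y (Y y)) (fderiv ℝ T y (X y))]
  ring

end Flat

/-! ### Passing to a parametrization -/

section Parametrization

variable {E : Type*} [NormedAddCommGroup E] [NormedSpace ℝ E] [FiniteDimensional ℝ E]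
  {H : Type*} [TopologicalSpace H] {I : ModelWithCorners ℝ E H}
  {M : Type*} [TopologicalSpace M] [ChartedSpace H M] [IsManifold I ∞ M]
  {W : Type*} [NormedAddCommGroup W] [NormedSpace ℝ W] [FiniteDimensional ℝ W]
  (Ψ : PartialDiffeomorph 𝓘(ℝ, W) I W M ∞)

/-- A vector field on `M`, read in the parametrization `Ψ`. -/
def fieldInCoord (X : ∀ p : M, TangentSpace I p) : W → W :=
  VectorField.mpullback 𝓘(ℝ, W) I Ψ X

/-- A field of bilinear forms on `M`, read in the parametrization `Ψ`. -/
def metricInCoord (g : BilinField I M) (y : W) : W →L[ℝ] W →L[ℝ] ℝ :=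
  LinearMap.toContinuousBilinearMap
    ((g (Ψ y)).compl₁₂ (mfderiv 𝓘(ℝ, W) I Ψ y).toLinearMap (mfderiv 𝓘(ℝ, W) I Ψ y).toLinearMap)

lemma metricInCoord_apply (g : BilinField I M) (y u v : W) :
    metricInCoord Ψ g y u v =
      g (Ψ y) (mfderiv 𝓘(ℝ, W) I Ψ y u) (mfderiv 𝓘(ℝ, W) I Ψ y v) := rfl

variable {Ψ} {y : W}

lemma contMDiffAt_param (hy : y ∈ Ψ.source) : ContMDiffAt 𝓘(ℝ, W) I ∞ Ψ y :=
  Ψ.contMDiffOn.contMDiffAt (Ψ.open_source.mem_nhds hy)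

lemma mdifferentiableAt_param (hy : y ∈ Ψ.source) : MDifferentiableAt 𝓘(ℝ, W) I Ψ y :=
  (contMDiffAt_param hy).mdifferentiableAt (by simp)

lemma isInvertible_mfderiv_param (hy : y ∈ Ψ.source) :
    (mfderiv 𝓘(ℝ, W) I Ψ y).IsInvertible :=
  ⟨(PartialDiffeomorph.isLocalDiffeomorphAt _ _ _ Ψ hy).mfderivToContinuousLinearEquiv (by simp),
    rfl⟩

lemma mfderiv_fieldInCoord (hy : y ∈ Ψ.source) (X : ∀ p : M, TangentSpace I p) :
    mfderiv 𝓘(ℝ, W) I Ψ y (fieldInCoord Ψ X y : W) = X (Ψ y) :=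
  (isInvertible_mfderiv_param hy).self_apply_inverse _

lemma metricInCoord_fieldInCoord (hy : y ∈ Ψ.source) (g : BilinField I M)
    (X Y : ∀ p : M, TangentSpace I p) :
    metricInCoord Ψ g y (fieldInCoord Ψ X y) (fieldInCoord Ψ Y y) =
      g (Ψ y) (X (Ψ y)) (Y (Ψ y)) := by
  rw [metricInCoord_apply, mfderiv_fieldInCoord hy, mfderiv_fieldInCoord hy]

lemma contDiffAt_fieldInCoord (hy : y ∈ Ψ.source) {X : ∀ p : M, TangentSpace I p} {U : Set M}
    (hX : IsSmoothVectorFieldOn I X U) (hU : IsOpen U) (hyU : Ψ y ∈ U) :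
    ContDiffAt ℝ ∞ (fieldInCoord Ψ X) y :=
  contMDiffAt_vectorSpace_iff_contDiffAt.1
    ((hX.contMDiffAt (hU.mem_nhds hyU)).mpullback_vectorField_preimage (n := ∞)
      (contMDiffAt_param hy) (isInvertible_mfderiv_param hy) (by simp))

lemma derivAlong_param (hy : y ∈ Ψ.source) (X : ∀ p : M, TangentSpace I p) {h : M → ℝ}
    (hh : MDifferentiableAt I 𝓘(ℝ) h (Ψ y)) :
    derivAlong I X h (Ψ y) = fderiv ℝ (fun x => h (Ψ x)) y (fieldInCoord Ψ X y) := by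
  have h1 := mfderiv_comp y hh (mdifferentiableAt_param hy)
  have h2 : fderiv ℝ (fun x => h (Ψ x)) y = mfderiv 𝓘(ℝ, W) 𝓘(ℝ) (h ∘ Ψ) y := by
    rw [mfderiv_eq_fderiv]; rfl
  rw [h2, h1, derivAlong, ← mfderiv_fieldInCoord hy X]
  rfl

lemma mlieBracket_param (hy : y ∈ Ψ.source) {X Y : ∀ p : M, TangentSpace I p} {U : Set M}
    (hU : IsOpen U) (hyU : Ψ y ∈ U)
    (hX : IsSmoothVectorFieldOn I X U) (hY : IsSmoothVectorFieldOn I Y U) :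
    VectorField.mlieBracket I X Y (Ψ y) =
      mfderiv 𝓘(ℝ, W) I Ψ y
        (VectorField.lieBracket ℝ (fieldInCoord Ψ X) (fieldInCoord Ψ Y) y : W) := by
  have hX' := (hX.contMDiffAt (hU.mem_nhds hyU)).mdifferentiableAt (by simp)
  have hY' := (hY.contMDiffAt (hU.mem_nhds hyU)).mdifferentiableAt (by simp)
  have : IsManifold I (minSmoothness ℝ 2) M :=
    IsManifold.of_le (n := ∞) (by rw [minSmoothness_of_isRCLikeNormedField]; exact ENat.LEInfty.out)
  have h := VectorField.mpullback_mlieBracket hX' hY' (contMDiffAt_param hy)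
    (by rw [minSmoothness_of_isRCLikeNormedField]; exact ENat.LEInfty.out)
  rw [← mfderiv_fieldInCoord hy (VectorField.mlieBracket I X Y)]
  congr 1
  rw [fieldInCoord, h, ← VectorField.mlieBracketWithin_univ,
    VectorField.mlieBracketWithin_eq_lieBracketWithin]
  exact congrFun VectorField.lieBracketWithin_univ y

variable (Ψ) in
/-- The vector field on `M` that is constant, equal to `u`, in the parametrization `Ψ`. -/
def constField (u : W) : ∀ p : M, TangentSpace I p :=
  VectorField.mpullback I 𝓘(ℝ, W) Ψ.symm (fun x => (NormedSpace.fromTangentSpace x).symm u)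

lemma mfderiv_symm_param (hy : y ∈ Ψ.source) (u : W) :
    mfderiv I 𝓘(ℝ, W) Ψ.symm (Ψ y) (mfderiv 𝓘(ℝ, W) I Ψ y u) = u := by
  have hs : MDifferentiableAt I 𝓘(ℝ, W) Ψ.symm (Ψ y) :=
    Ψ.symm.mdifferentiableAt (by simp) (Ψ.map_source hy)
  have h1 := mfderiv_comp y hs (mdifferentiableAt_param hy)
  have h2 : mfderiv 𝓘(ℝ, W) 𝓘(ℝ, W) (Ψ.symm ∘ Ψ) y = ContinuousLinearMap.id ℝ W := by
    have : (Ψ.symm ∘ Ψ) =ᶠ[𝓝 y] id := by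
      filter_upwards [Ψ.open_source.mem_nhds hy] with x hx using Ψ.left_inv hx
    rw [this.mfderiv_eq, mfderiv_id]
    rfl
  exact congrArg (fun A => A u) (h1.symm.trans h2)

lemma isInvertible_mfderiv_param_symm {p : M} (hp : p ∈ Ψ.target) :
    (mfderiv I 𝓘(ℝ, W) Ψ.symm p).IsInvertible :=
  ⟨(PartialDiffeomorph.isLocalDiffeomorphAt _ _ _ Ψ.symm
    hp).mfderivToContinuousLinearEquiv (by simp), rfl⟩

lemma constField_param (hy : y ∈ Ψ.source) (u : W) :
    constField Ψ u (Ψ y) = mfderiv 𝓘(ℝ, W) I Ψ y u := by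
  have := (isInvertible_mfderiv_param_symm (Ψ.map_source hy)).inverse_apply_self
    (mfderiv 𝓘(ℝ, W) I Ψ y u)
  rw [mfderiv_symm_param hy] at this
  exact this

lemma fieldInCoord_constField (hy : y ∈ Ψ.source) (u : W) :
    fieldInCoord Ψ (constField Ψ u) y = u := by
  apply (isInvertible_mfderiv_param hy).injective
  rw [mfderiv_fieldInCoord hy, constField_param hy]

variable (Ψ) in
lemma isSmoothVectorFieldOn_constField (u : W) :
    IsSmoothVectorFieldOn I (constField Ψ u) Ψ.target := by
  intro p hp
  refine (ContMDiffAt.mpullback_vectorField_preimage (n := ∞) ?_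
    (Ψ.symm.contMDiffOn.contMDiffAt (Ψ.open_target.mem_nhds hp))
    (isInvertible_mfderiv_param_symm hp) (by simp)).contMDiffWithinAt
  exact contMDiffAt_vectorSpace_iff_contDiffAt.2 (contDiffAt_const (c := u))

lemma contDiffOn_comp_param {h : M → ℝ} (hh : ContMDiffOn I 𝓘(ℝ) ∞ h Ψ.target) :
    ContDiffOn ℝ ∞ (fun x => h (Ψ x)) Ψ.source :=
  (hh.comp Ψ.contMDiffOn Ψ.mapsTo).contDiffOn

variable (Ψ) in
lemma contDiffOn_metricInCoord {g : BilinField I M} (hg : IsSingularMetric g) :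
    ContDiffOn ℝ ∞ (metricInCoord Ψ g) Ψ.source := by
  refine contDiffOn_clm_apply.2 fun u => contDiffOn_clm_apply.2 fun v => ?_
  refine (contDiffOn_comp_param (hg.smooth Ψ.target Ψ.open_target (constField Ψ u) (constField Ψ v)
    (isSmoothVectorFieldOn_constField Ψ u) (isSmoothVectorFieldOn_constField Ψ v))).congr ?_
  intro x hx
  simp only [constField_param hx]
  rfl

lemma contDiffAt_metricInCoord {g : BilinField I M} (hg : IsSingularMetric g)
    (hy : y ∈ Ψ.source) : ContDiffAt ℝ ∞ (metricInCoord Ψ g) y :=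
  (contDiffOn_metricInCoord Ψ hg).contDiffAt (Ψ.open_source.mem_nhds hy)

variable (Ψ) in
lemma metricInCoord_symm {g : BilinField I M} (hg : IsSingularMetric g) (x u v : W) :
    metricInCoord Ψ g x u v = metricInCoord Ψ g x v u :=
  hg.symm _ _ _

/-- The Koszul form of a metric on `M` is computed in a parametrization by the formula
`𝒦(X, Y, Z) = ⟨D_X Y, Z⟩ + Γ(X, Y, Z)` of the vector space. -/
lemma koszul_param {g : BilinField I M} (hg : IsSingularMetric g) (hy : y ∈ Ψ.source)
    {X Y Z : ∀ p : M, TangentSpace I p} {U : Set M} (hU : IsOpen U) (hyU : Ψ y ∈ U)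
    (hX : IsSmoothVectorFieldOn I X U) (hY : IsSmoothVectorFieldOn I Y U)
    (hZ : IsSmoothVectorFieldOn I Z U) :
    koszul g X Y Z (Ψ y) =
      metricInCoord Ψ g y (fderiv ℝ (fieldInCoord Ψ Y) y (fieldInCoord Ψ X y)) (fieldInCoord Ψ Z y)
      + christoffel (metricInCoord Ψ g) y (fieldInCoord Ψ X y) (fieldInCoord Ψ Y y)
        (fieldInCoord Ψ Z y) := by
  have hd : ∀ {V : ∀ p : M, TangentSpace I p}, IsSmoothVectorFieldOn I V U →
      DifferentiableAt ℝ (fieldInCoord Ψ V) y := fun hV =>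
    (contDiffAt_fieldInCoord hy hV hU hyU).differentiableAt (by simp)
  rw [← flat_koszul (Filter.Eventually.of_forall (metricInCoord_symm Ψ hg))
    ((contDiffAt_metricInCoord hg hy).differentiableAt (by simp)) (hd hX) (hd hY) (hd hZ)]
  have hder : ∀ {V V' : ∀ p : M, TangentSpace I p} (T : ∀ p : M, TangentSpace I p),
      IsSmoothVectorFieldOn I V U → IsSmoothVectorFieldOn I V' U →
      derivAlong I T (fun q => g q (V q) (V' q)) (Ψ y) =
        fderiv ℝ (fun x => metricInCoord Ψ g x (fieldInCoord Ψ V x) (fieldInCoord Ψ V' x)) y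
          (fieldInCoord Ψ T y) := by
    intro V V' T hV hV'
    rw [derivAlong_param hy T
      (((hg.smooth U hU V V' hV hV').contMDiffAt (hU.mem_nhds hyU)).mdifferentiableAt (by simp))]
    congr 1
    apply Filter.EventuallyEq.fderiv_eq
    filter_upwards [Ψ.open_source.mem_nhds hy] with x hx
    rw [metricInCoord_fieldInCoord hx]
  rw [koszul, hder X hY hZ, hder Y hZ hX, hder Z hX hY, mlieBracket_param hy hU hyU hY hZ,
    mlieBracket_param hy hU hyU hZ hX, mlieBracket_param hy hU hyU hX hY,
    ← mfderiv_fieldInCoord hy X, ← mfderiv_fieldInCoord hy Y, ← mfderiv_fieldInCoord hy Z]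
  rfl

end Parametrization

/-! ### Contractions and curvature in a parametrization -/

section Connection

variable {E : Type*} [NormedAddCommGroup E] [NormedSpace ℝ E] [FiniteDimensional ℝ E]
  {H : Type*} [TopologicalSpace H] {I : ModelWithCorners ℝ E H}
  {M : Type*} [TopologicalSpace M] [ChartedSpace H M] [IsManifold I ∞ M]
  {W : Type*} [NormedAddCommGroup W] [NormedSpace ℝ W] [FiniteDimensional ℝ W]
  {Ψ : PartialDiffeomorph 𝓘(ℝ, W) I W M ∞} {y : W}

/-- The covariant derivative `D_X Y + S(X, Y)` of vector fields on a vector space. -/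
def flatConnection (S : W → W → W → W) (X Y : W → W) (y : W) : W :=
  fderiv ℝ Y y (X y) + S y (X y) (Y y)

/-- If `S` raises the last index of the Christoffel symbols, the vector `D_X Y + S(X, Y)` represents
`𝒦(X, Y, _)`. -/
lemma representsKoszul_param {g : BilinField I M} (hg : IsSingularMetric g) (hy : y ∈ Ψ.source)
    {X Y : ∀ p : M, TangentSpace I p} {U : Set M} (hU : IsOpen U) (hyU : Ψ y ∈ U)
    (hX : IsSmoothVectorFieldOn I X U) (hY : IsSmoothVectorFieldOn I Y U)
    {S : W → W → W → W} (hS : IsChristoffelSharp (metricInCoord Ψ g) S y) :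
    RepresentsKoszul g X Y (Ψ y) (mfderiv 𝓘(ℝ, W) I Ψ y
      (flatConnection S (fieldInCoord Ψ X) (fieldInCoord Ψ Y) y : W)) := by
  intro V hV hyV Z hZ
  rw [koszul_param hg hy (hU.inter hV) ⟨hyU, hyV⟩ (hX.mono Set.inter_subset_left)
    (hY.mono Set.inter_subset_left) (hZ.mono Set.inter_subset_right), ← hS,
    ← mfderiv_fieldInCoord hy Z, ← metricInCoord_apply, flatConnection, map_add, add_apply]

/-- Two vectors that represent the same Koszul form differ by a vector in the kernel of `♭`. -/
lemma RepresentsKoszul.apply_eq {g : BilinField I M} (hy : y ∈ Ψ.source)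
    {X Y : ∀ p : M, TangentSpace I p} {w w' : TangentSpace I (Ψ y)}
    (hw : RepresentsKoszul g X Y (Ψ y) w) (hw' : RepresentsKoszul g X Y (Ψ y) w')
    (v : TangentSpace I (Ψ y)) : g (Ψ y) w v = g (Ψ y) w' v := by
  obtain ⟨u, rfl⟩ : ∃ u : W, mfderiv 𝓘(ℝ, W) I Ψ y u = v :=
    (isInvertible_mfderiv_param hy).surjective v
  have h := hw Ψ.target Ψ.open_target (Ψ.map_source hy) _ (isSmoothVectorFieldOn_constField Ψ u)
  have h' := hw' Ψ.target Ψ.open_target (Ψ.map_source hy) _ (isSmoothVectorFieldOn_constField Ψ u)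
  rw [constField_param hy] at h h'
  exact h.symm.trans h'

lemma representsKoszul_koszulSharp {g : BilinField I M} {X Y : ∀ p : M, TangentSpace I p} {p : M}
    (h : ∃ w, RepresentsKoszul g X Y p w) : RepresentsKoszul g X Y p (koszulSharp g X Y p) := by
  rw [koszulSharp, dif_pos h]
  exact h.choose_spec

/-- The contraction does not depend on the choice of the vectors that represent the Koszul form, so
it can be computed with any map `S` that raises the last index of the Christoffel symbols. -/
lemma koszulContraction_param {g : BilinField I M} (hg : IsSingularMetric g) (hy : y ∈ Ψ.source)
    {X Y Z T : ∀ p : M, TangentSpace I p} {U : Set M} (hU : IsOpen U) (hyU : Ψ y ∈ U)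
    (hX : IsSmoothVectorFieldOn I X U) (hY : IsSmoothVectorFieldOn I Y U)
    (hZ : IsSmoothVectorFieldOn I Z U) (hT : IsSmoothVectorFieldOn I T U)
    {S : W → W → W → W} (hS : IsChristoffelSharp (metricInCoord Ψ g) S y) :
    koszulContraction g X Y Z T (Ψ y) = metricInCoord Ψ g y
      (flatConnection S (fieldInCoord Ψ X) (fieldInCoord Ψ Y) y)
      (flatConnection S (fieldInCoord Ψ Z) (fieldInCoord Ψ T) y) := by
  have h1 := representsKoszul_param hg hy hU hyU hX hY hS
  have h2 := representsKoszul_param hg hy hU hyU hZ hT hS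
  rw [koszulContraction, (representsKoszul_koszulSharp ⟨_, h1⟩).apply_eq hy h1, hg.symm,
    (representsKoszul_koszulSharp ⟨_, h2⟩).apply_eq hy h2, hg.symm]
  rfl

/-- The extended chart `e` of a manifold without boundary, as a parametrization. -/
def chartParam [I.Boundaryless] (e : OpenPartialHomeomorph M H)
    (he : e ∈ IsManifold.maximalAtlas I ∞ M) : PartialDiffeomorph 𝓘(ℝ, E) I E M ∞ where
  toPartialEquiv := (e.extend I).symm
  open_source := e.isOpen_extend_target
  open_target := by simpa using e.open_source
  contMDiffOn_toFun := by
    have := contMDiffOn_extend_symm he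
    rwa [← e.extend_target'] at this
  contMDiffOn_invFun := by
    simpa using! OpenPartialHomeomorph.contMDiffOn_extend he

lemma coordField_eq_constField [I.Boundaryless] {e : OpenPartialHomeomorph M H}
    (he : e ∈ IsManifold.maximalAtlas I ∞ M) {ι : Type*} (b : Module.Basis ι ℝ E) (a : ι) :
    coordField I e b a = constField (chartParam e he) (b a) := rfl

lemma isSmoothVectorFieldOn_coordField [I.Boundaryless] {e : OpenPartialHomeomorph M H}
    (he : e ∈ IsManifold.maximalAtlas I ∞ M) {ι : Type*} (b : Module.Basis ι ℝ E) (a : ι) :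
    IsSmoothVectorFieldOn I (coordField I e b a) e.source := by
  have h := isSmoothVectorFieldOn_constField (chartParam e he) (b a)
  rwa [show (chartParam e he).target = e.source from e.extend_source] at h

lemma mlieBracket_constField {p : M} (hp : p ∈ Ψ.target) (u v : W) :
    VectorField.mlieBracket I (constField Ψ u) (constField Ψ v) p = 0 := by
  obtain ⟨x, hx, rfl⟩ : ∃ x ∈ Ψ.source, Ψ x = p :=
    ⟨Ψ.symm p, Ψ.map_target hp, Ψ.right_inv hp⟩
  rw [mlieBracket_param hx Ψ.open_target hp (isSmoothVectorFieldOn_constField Ψ u)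
    (isSmoothVectorFieldOn_constField Ψ v)]
  have h : ∀ u : W, fieldInCoord Ψ (constField Ψ u) =ᶠ[𝓝 x] fun _ => u := fun u => by
    filter_upwards [Ψ.open_source.mem_nhds hx] with z hz using fieldInCoord_constField hz u
  have : VectorField.lieBracket ℝ (fieldInCoord Ψ (constField Ψ u))
      (fieldInCoord Ψ (constField Ψ v)) x = 0 := by
    rw [VectorField.lieBracket_eq]
    simp only [(h _).fderiv_eq, fderiv_fun_const]
    simp
  rw [this]
  exact map_zero _

lemma derivAlong_koszul_param {g : BilinField I M} (hg : IsSingularMetric g) (hy : y ∈ Ψ.source)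
    (X : ∀ p : M, TangentSpace I p) {Y Z T : ∀ p : M, TangentSpace I p} {U : Set M} (hU : IsOpen U)
    (hyU : Ψ y ∈ U) (hY : IsSmoothVectorFieldOn I Y U)
    (hZ : IsSmoothVectorFieldOn I Z U) (hT : IsSmoothVectorFieldOn I T U) :
    derivAlong I X (koszul g Y Z T) (Ψ y) =
      fderiv ℝ (fun x => metricInCoord Ψ g x (fderiv ℝ (fieldInCoord Ψ Z) x (fieldInCoord Ψ Y x))
        (fieldInCoord Ψ T x) + christoffel (metricInCoord Ψ g) x (fieldInCoord Ψ Y x)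
        (fieldInCoord Ψ Z x) (fieldInCoord Ψ T x)) y (fieldInCoord Ψ X y) := by
  set K : W → ℝ := fun x =>
    metricInCoord Ψ g x (fderiv ℝ (fieldInCoord Ψ Z) x (fieldInCoord Ψ Y x))
      (fieldInCoord Ψ T x) + christoffel (metricInCoord Ψ g) x (fieldInCoord Ψ Y x)
        (fieldInCoord Ψ Z x) (fieldInCoord Ψ T x) with hK
  have hd : ∀ {V : ∀ p : M, TangentSpace I p}, IsSmoothVectorFieldOn I V U →
      ContDiffAt ℝ ∞ (fieldInCoord Ψ V) y := fun hV =>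
    contDiffAt_fieldInCoord hy hV hU hyU
  have hKd : DifferentiableAt ℝ K y := differentiableAt_flat_koszul (contDiffAt_metricInCoord hg hy)
    ((hd hY).differentiableAt (by simp)) (hd hZ) ((hd hT).differentiableAt (by simp))
  have hopen : IsOpen (Ψ.source ∩ Ψ ⁻¹' U) :=
    Ψ.contMDiffOn.continuousOn.isOpen_inter_preimage Ψ.open_source hU
  have hkos : ∀ x ∈ Ψ.source ∩ Ψ ⁻¹' U, koszul g Y Z T (Ψ x) = K x := fun x hx =>
    koszul_param hg hx.1 hU hx.2 hY hZ hT
  have hopen' : IsOpen (Ψ.target ∩ Ψ.symm ⁻¹' (Ψ.source ∩ Ψ ⁻¹' U)) :=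
    Ψ.symm.contMDiffOn.continuousOn.isOpen_inter_preimage Ψ.open_target hopen
  have hinv : Ψ.symm (Ψ y) = y := Ψ.left_inv hy
  have hM : koszul g Y Z T =ᶠ[𝓝 (Ψ y)] fun q => K (Ψ.symm q) := by
    filter_upwards [hopen'.mem_nhds ⟨Ψ.map_source hy, by
      rw [Set.mem_preimage, hinv]; exact ⟨hy, hyU⟩⟩] with q hq
    rw [← hkos _ hq.2]
    congr 1
    exact (Ψ.right_inv hq.1).symm
  have hMd : MDifferentiableAt I 𝓘(ℝ) (koszul g Y Z T) (Ψ y) := by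
    refine MDifferentiableAt.congr_of_eventuallyEq ?_ hM
    have h1 : MDifferentiableAt 𝓘(ℝ, W) 𝓘(ℝ) K (Ψ.symm (Ψ y)) := by
      rw [hinv]; exact hKd.mdifferentiableAt
    exact h1.comp _ (Ψ.symm.mdifferentiableAt (by simp) (Ψ.map_source hy))
  rw [derivAlong_param hy X hMd]
  congr 1
  apply Filter.EventuallyEq.fderiv_eq
  filter_upwards [hopen.mem_nhds ⟨hy, hyU⟩] with x hx using hkos x hx

/-- The components of the Riemann curvature in any chart are the values of one tensor,
which can be computed in any other parametrization. -/
lemma riemann_param [I.Boundaryless] {g : BilinField I M} (hg : IsSingularMetric g)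
    (hy : y ∈ Ψ.source) {e : OpenPartialHomeomorph M H}
    (he : e ∈ IsManifold.maximalAtlas I ∞ M) (hye : Ψ y ∈ e.source) {ι : Type*}
    (b : Module.Basis ι ℝ E) {S : W → W → W → W}
    (hS : IsChristoffelSharp (metricInCoord Ψ g) S y) (i j k l : ι) :
    riemann g e b (Ψ y) i j k l = flatRiemann (metricInCoord Ψ g) S y
      (fieldInCoord Ψ (coordField I e b i) y) (fieldInCoord Ψ (coordField I e b j) y)
      (fieldInCoord Ψ (coordField I e b k) y) (fieldInCoord Ψ (coordField I e b l) y) := by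
  have hs := isSmoothVectorFieldOn_coordField he b
  have ho := e.open_source
  have hc : ∀ a, ContDiffAt ℝ ∞ (fieldInCoord Ψ (coordField I e b a)) y := fun a =>
    contDiffAt_fieldInCoord hy (hs a) ho hye
  have hbr : VectorField.lieBracket ℝ (fieldInCoord Ψ (coordField I e b i))
      (fieldInCoord Ψ (coordField I e b j)) y = 0 := by
    have h1 : VectorField.mlieBracket I (coordField I e b i) (coordField I e b j) (Ψ y) = 0 :=
      mlieBracket_constField (Ψ := chartParam e he) (by
        rwa [show (chartParam e he).target = e.source from e.extend_source]) (b i) (b j)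
    rw [mlieBracket_param hy ho hye (hs i) (hs j)] at h1
    exact (isInvertible_mfderiv_param hy).injective (h1.trans (map_zero _).symm)
  rw [riemann, derivAlong_koszul_param hg hy _ ho hye (hs j) (hs k) (hs l),
    derivAlong_koszul_param hg hy _ ho hye (hs i) (hs k) (hs l),
    koszulContraction_param hg hy ho hye (hs i) (hs k) (hs j) (hs l) hS,
    koszulContraction_param hg hy ho hye (hs j) (hs k) (hs i) (hs l) hS]
  exact flat_riemann_of_commute (Filter.Eventually.of_forall (metricInCoord_symm Ψ hg))
    (contDiffAt_metricInCoord hg hy) hS (hc i) (hc j) (hc k) (hc l) hbr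

end Connection

/-! ### The Levi-Civita connection of a semi-Riemannian metric on a vector space -/

section Fiber

variable {V : Type*} [NormedAddCommGroup V] [NormedSpace ℝ V]

/-- The covector `Γ(u, v, _)` at `x`. -/
def christoffelCovector (h : V → V →L[ℝ] V →L[ℝ] ℝ) (x u v : V) : V →L[ℝ] ℝ :=
  (1 / 2 : ℝ) • (fderiv ℝ h x u v + (fderiv ℝ h x v).flip u - ((fderiv ℝ h x).flip u).flip v)

lemma christoffelCovector_apply (h : V → V →L[ℝ] V →L[ℝ] ℝ) (x u v w : V) :
    christoffelCovector h x u v w = christoffel h x u v w := by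
  simp [christoffelCovector, christoffel]

variable [FiniteDimensional ℝ V]

/-- The Christoffel symbols of the second kind of a metric `h` on a vector space. -/
def christoffelSecond (h : V → V →L[ℝ] V →L[ℝ] ℝ) (x : V) : V →L[ℝ] V →L[ℝ] V :=
  LinearMap.toContinuousBilinearMap (LinearMap.mk₂ ℝ
    (fun u v => (h x).inverse (christoffelCovector h x u v))
    (fun u u' v => by
      rw [← map_add]; congr 1; ext w; simp [christoffelCovector]; ring)
    (fun c u v => by
      rw [← map_smul]; congr 1; ext w; simp [christoffelCovector]; ring)
    (fun u v v' => by
      rw [← map_add]; congr 1; ext w; simp [christoffelCovector]; ring)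
    (fun c u v => by
      rw [← map_smul]; congr 1; ext w; simp [christoffelCovector]; ring))

lemma christoffelSecond_apply (h : V → V →L[ℝ] V →L[ℝ] ℝ) (x u v : V) :
    christoffelSecond h x u v = (h x).inverse (christoffelCovector h x u v) := rfl

lemma isInvertible_of_nondegenerate {q : V →L[ℝ] V →L[ℝ] ℝ}
    (hq : ∀ v, (∀ w, q v w = 0) → v = 0) : q.IsInvertible := by
  have hinj : Function.Injective q.toLinearMap := by
    rw [← LinearMap.ker_eq_bot, LinearMap.ker_eq_bot']
    intro v hv
    exact hq v fun w => congrArg (fun A : V →L[ℝ] ℝ => A w) hv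
  have hdim : Module.finrank ℝ V = Module.finrank ℝ (V →L[ℝ] ℝ) := by
    rw [← (LinearMap.toContinuousLinearMap (𝕜 := ℝ) (E := V) (F' := ℝ)).finrank_eq]
    exact Subspace.dual_finrank_eq.symm
  exact ⟨(LinearEquiv.ofInjectiveOfFinrankEq q.toLinearMap hinj hdim).toContinuousLinearEquiv, by
    ext; rfl⟩

variable {O : Set V} {h : V → V →L[ℝ] V →L[ℝ] ℝ}

lemma isChristoffelSharp_christoffelSecond {x : V} (hx : (h x).IsInvertible) :
    IsChristoffelSharp h (fun x u v => christoffelSecond h x u v) x := by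
  intro u v w
  beta_reduce
  rw [christoffelSecond_apply, hx.self_apply_inverse, christoffelCovector_apply]

lemma contDiffOn_inverse_metric (hh : ContDiffOn ℝ ∞ h O) (hinv : ∀ x ∈ O, (h x).IsInvertible) :
    ContDiffOn ℝ ∞ (fun x => (h x).inverse) O := fun x hx =>
  ((hinv x hx).contDiffAt_map_inverse).comp_contDiffWithinAt x (hh x hx)

lemma contDiffOn_christoffel (hO : IsOpen O) (hh : ContDiffOn ℝ ∞ h O) (u v w : V) :
    ContDiffOn ℝ ∞ (fun x => christoffel h x u v w) O := by
  have hd : ContDiffOn ℝ ∞ (fderiv ℝ h) O := hh.fderiv_of_isOpen hO (by simp)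
  have hd' : ∀ u v w : V, ContDiffOn ℝ ∞ (fun x => fderiv ℝ h x u v w) O := fun u v w =>
    ((hd.clm_apply contDiffOn_const).clm_apply contDiffOn_const).clm_apply contDiffOn_const
  exact contDiffOn_const.mul (((hd' u v w).add (hd' v w u)).sub (hd' w u v))

lemma contDiffOn_christoffelSecond (hO : IsOpen O) (hh : ContDiffOn ℝ ∞ h O)
    (hinv : ∀ x ∈ O, (h x).IsInvertible) : ContDiffOn ℝ ∞ (christoffelSecond h) O := by
  refine contDiffOn_clm_apply.2 fun u => contDiffOn_clm_apply.2 fun v => ?_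
  refine (contDiffOn_inverse_metric hh hinv).clm_apply (contDiffOn_clm_apply.2 fun w => ?_)
  simp only [christoffelCovector_apply]
  exact contDiffOn_christoffel hO hh u v w

/-- The curvature tensor of a metric `h` on a vector space, written in a form that is visibly
multilinear in `u`, `v`, `z`, `t`. -/
def curvatureForm (h : V → V →L[ℝ] V →L[ℝ] ℝ) (x u v z t : V) : ℝ :=
  (1 / 2) * (fderiv ℝ (fderiv ℝ h) x u v z t + fderiv ℝ (fderiv ℝ h) x u z t v
    - fderiv ℝ (fderiv ℝ h) x u t v z)
  - (1 / 2) * (fderiv ℝ (fderiv ℝ h) x v u z t + fderiv ℝ (fderiv ℝ h) x v z t u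
    - fderiv ℝ (fderiv ℝ h) x v t u z)
  + h x (christoffelSecond h x u z) (christoffelSecond h x v t)
  - h x (christoffelSecond h x v z) (christoffelSecond h x u t)

lemma flatRiemann_eq_curvatureForm {x : V} (hh : ContDiffAt ℝ ∞ h x) (u v z t : V) :
    flatRiemann h (fun x u v => christoffelSecond h x u v) x u v z t =
      curvatureForm h x u v z t := by
  rw [flatRiemann, fderiv_christoffel_const hh, fderiv_christoffel_const hh, curvatureForm]

lemma contDiffOn_curvatureForm (hO : IsOpen O) (hh : ContDiffOn ℝ ∞ h O)
    (hinv : ∀ x ∈ O, (h x).IsInvertible) (u v z t : V) :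
    ContDiffOn ℝ ∞ (fun x => curvatureForm h x u v z t) O := by
  have hd : ContDiffOn ℝ ∞ (fderiv ℝ (fderiv ℝ h)) O :=
    (hh.fderiv_of_isOpen hO (m := ∞) (by simp)).fderiv_of_isOpen hO (by simp)
  have hd' : ∀ a b c d : V, ContDiffOn ℝ ∞ (fun x => fderiv ℝ (fderiv ℝ h) x a b c d) O :=
    fun a b c d => (((hd.clm_apply contDiffOn_const).clm_apply contDiffOn_const).clm_apply
      contDiffOn_const).clm_apply contDiffOn_const
  have hc : ∀ a b : V, ContDiffOn ℝ ∞ (fun x => christoffelSecond h x a b) O := fun a b =>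
    ((contDiffOn_christoffelSecond hO hh hinv).clm_apply contDiffOn_const).clm_apply
      contDiffOn_const
  exact (((contDiffOn_const.mul (((hd' _ _ _ _).add (hd' _ _ _ _)).sub (hd' _ _ _ _))).sub
    (contDiffOn_const.mul (((hd' _ _ _ _).add (hd' _ _ _ _)).sub (hd' _ _ _ _)))).add
    ((hh.clm_apply (hc _ _)).clm_apply (hc _ _))).sub ((hh.clm_apply (hc _ _)).clm_apply (hc _ _))

end Fiber

/-! ### The warped metric `β dt² + f² h` in coordinates -/

/-- A warped product with one-dimensional base in coordinates, namely the metric `β dt² + f² h` on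
`base × fiber`, where `base` and `fiber` are open subsets of `ℝ` and of a vector space `V`. -/
structure WarpedModel (V : Type*) [NormedAddCommGroup V] [NormedSpace ℝ V] where
  /-- The domain of the coordinate of the base. -/
  base : Set ℝ
  /-- The domain of the coordinates of the fibre. -/
  fiber : Set V
  /-- The metric of the base. -/
  β : ℝ → ℝ
  /-- The warping function. -/
  f : ℝ → ℝ
  /-- The metric of the fibre. -/
  h : V → V →L[ℝ] V →L[ℝ] ℝ
  isOpen_base : IsOpen base
  isOpen_fiber : IsOpen fiber
  contDiffOn_β : ContDiffOn ℝ ∞ β base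
  contDiffOn_f : ContDiffOn ℝ ∞ f base
  contDiffOn_h : ContDiffOn ℝ ∞ h fiber
  β_ne_zero : ∀ t ∈ base, β t ≠ 0
  symm_h : ∀ x v w, h x v w = h x w v
  nondegenerate_h : ∀ x ∈ fiber, ∀ v, (∀ w, h x v w = 0) → v = 0

namespace WarpedModel

variable {V : Type*} [NormedAddCommGroup V] [NormedSpace ℝ V] (D : WarpedModel V)

/-- The coordinate domain. -/
def domain : Set (ℝ × V) := D.base ×ˢ D.fiber

lemma isOpen_domain : IsOpen D.domain := D.isOpen_base.prod D.isOpen_fiber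

/-- The form `dt²` on `ℝ × V`. -/
def dtSq : (ℝ × V) →L[ℝ] (ℝ × V) →L[ℝ] ℝ :=
  (ContinuousLinearMap.mul ℝ ℝ).bilinearComp (ContinuousLinearMap.fst ℝ ℝ V)
    (ContinuousLinearMap.fst ℝ ℝ V)

/-- The pullback to `ℝ × V` of a bilinear form on `V`. -/
def vertical (q : V →L[ℝ] V →L[ℝ] ℝ) : (ℝ × V) →L[ℝ] (ℝ × V) →L[ℝ] ℝ :=
  q.bilinearComp (ContinuousLinearMap.snd ℝ ℝ V) (ContinuousLinearMap.snd ℝ ℝ V)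

@[simp] lemma dtSq_apply (u v : ℝ × V) : dtSq u v = u.1 * v.1 := rfl

@[simp] lemma vertical_apply (q : V →L[ℝ] V →L[ℝ] ℝ) (u v : ℝ × V) :
    vertical q u v = q u.2 v.2 := rfl

/-- The warped metric `β dt² + f² h`. -/
def metric (p : ℝ × V) : (ℝ × V) →L[ℝ] (ℝ × V) →L[ℝ] ℝ :=
  D.β p.1 • dtSq + D.f p.1 ^ 2 • vertical (D.h p.2)

lemma metric_apply (p u v : ℝ × V) :
    D.metric p u v = D.β p.1 * (u.1 * v.1) + D.f p.1 ^ 2 * D.h p.2 u.2 v.2 := rfl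

lemma metric_symm (p u v : ℝ × V) : D.metric p u v = D.metric p v u := by
  rw [metric_apply, metric_apply, D.symm_h, mul_comm u.1]

lemma contDiffOn_base {φ : ℝ → ℝ} (hφ : ContDiffOn ℝ ∞ φ D.base) :
    ContDiffOn ℝ ∞ (fun p : ℝ × V => φ p.1) D.domain :=
  hφ.comp contDiffOn_fst fun _ hp => hp.1

lemma contDiffOn_fiber {N : Type*} [NormedAddCommGroup N] [NormedSpace ℝ N] {φ : V → N}
    (hφ : ContDiffOn ℝ ∞ φ D.fiber) :
    ContDiffOn ℝ ∞ (fun p : ℝ × V => φ p.2) D.domain :=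
  hφ.comp contDiffOn_snd fun _ hp => hp.2

lemma contDiffOn_deriv_β : ContDiffOn ℝ ∞ (deriv D.β) D.base :=
  D.contDiffOn_β.deriv_of_isOpen D.isOpen_base (by simp)

lemma contDiffOn_deriv_f : ContDiffOn ℝ ∞ (deriv D.f) D.base :=
  D.contDiffOn_f.deriv_of_isOpen D.isOpen_base (by simp)

lemma contDiffOn_deriv_deriv_f : ContDiffOn ℝ ∞ (deriv (deriv D.f)) D.base :=
  D.contDiffOn_deriv_f.deriv_of_isOpen D.isOpen_base (by simp)

variable {D} {p : ℝ × V}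

lemma differentiableAt_of_base {φ : ℝ → ℝ} (hφ : ContDiffOn ℝ ∞ φ D.base) (hp : p ∈ D.domain) :
    DifferentiableAt ℝ φ p.1 :=
  (hφ.contDiffAt (D.isOpen_base.mem_nhds hp.1)).differentiableAt (by simp)

lemma contDiffAt_h (hp : p ∈ D.domain) : ContDiffAt ℝ ∞ D.h p.2 :=
  D.contDiffOn_h.contDiffAt (D.isOpen_fiber.mem_nhds hp.2)

lemma differentiableAt_h (hp : p ∈ D.domain) : DifferentiableAt ℝ D.h p.2 :=
  (contDiffAt_h hp).differentiableAt (by simp)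

lemma hasFDerivAt_base {φ : ℝ → ℝ} (hφ : DifferentiableAt ℝ φ p.1) :
    HasFDerivAt (fun q : ℝ × V => φ q.1) (deriv φ p.1 • ContinuousLinearMap.fst ℝ ℝ V) p :=
  hφ.hasDerivAt.comp_hasFDerivAt p hasFDerivAt_fst

lemma hasFDerivAt_fiber {φ : V → ℝ} (hφ : DifferentiableAt ℝ φ p.2) :
    HasFDerivAt (fun q : ℝ × V => φ q.2)
      ((fderiv ℝ φ p.2).comp (ContinuousLinearMap.snd ℝ ℝ V)) p :=
  hφ.hasFDerivAt.comp p hasFDerivAt_snd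

lemma differentiableAt_h_apply (hp : p ∈ D.domain) (v w : V) :
    DifferentiableAt ℝ (fun x => D.h x v w) p.2 :=
  ((differentiableAt_h hp).clm_apply (differentiableAt_const v)).clm_apply
    (differentiableAt_const w)

lemma fderiv_h_apply (hp : p ∈ D.domain) (u v w : V) :
    fderiv ℝ (fun x => D.h x v w) p.2 u = fderiv ℝ D.h p.2 u v w := by
  rw [fderiv_metric_apply (differentiableAt_h hp) (differentiableAt_const v)
    (differentiableAt_const w)]
  simp

variable [FiniteDimensional ℝ V]

lemma contDiffOn_vertical {q : ℝ × V → V →L[ℝ] V →L[ℝ] ℝ} {s : Set (ℝ × V)}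
    (hq : ContDiffOn ℝ ∞ q s) : ContDiffOn ℝ ∞ (fun p => vertical (q p)) s := by
  refine contDiffOn_clm_apply.2 fun u => contDiffOn_clm_apply.2 fun v => ?_
  exact (hq.clm_apply contDiffOn_const).clm_apply contDiffOn_const

variable (D) in
lemma contDiffOn_metric : ContDiffOn ℝ ∞ D.metric D.domain :=
  ((D.contDiffOn_base D.contDiffOn_β).smul contDiffOn_const).add
    (((D.contDiffOn_base D.contDiffOn_f).pow 2).smul
      (contDiffOn_vertical (D.contDiffOn_fiber D.contDiffOn_h)))

lemma contDiffAt_metric (hp : p ∈ D.domain) : ContDiffAt ℝ ∞ D.metric p :=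
  D.contDiffOn_metric.contDiffAt (D.isOpen_domain.mem_nhds hp)

lemma fderiv_metric (hp : p ∈ D.domain) (u v w : ℝ × V) :
    fderiv ℝ D.metric p u v w =
      deriv D.β p.1 * (u.1 * v.1 * w.1) + 2 * D.f p.1 * deriv D.f p.1 * u.1 * D.h p.2 v.2 w.2
        + D.f p.1 ^ 2 * fderiv ℝ D.h p.2 u.2 v.2 w.2 := by
  have h1 := fderiv_metric_apply ((contDiffAt_metric hp).differentiableAt (by simp))
    (differentiableAt_const v) (differentiableAt_const w) u
  have hβ := hasFDerivAt_base (differentiableAt_of_base D.contDiffOn_β hp)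
  have hf := hasFDerivAt_base (differentiableAt_of_base D.contDiffOn_f hp)
  have hh := hasFDerivAt_fiber (differentiableAt_h_apply hp v.2 w.2)
  have h2 := (hβ.mul_const (v.1 * w.1)).add ((hf.pow 2).mul hh)
  have h3 : fderiv ℝ (fun x => D.metric x v w) p = _ := h2.fderiv
  rw [h3] at h1
  simp [fderiv_h_apply hp] at h1
  rw [← h1]
  ring

lemma christoffel_metric (hp : p ∈ D.domain) (u v w : ℝ × V) :
    christoffel D.metric p u v w = (1 / 2) * deriv D.β p.1 * (u.1 * v.1 * w.1)
      + D.f p.1 ^ 2 * christoffel D.h p.2 u.2 v.2 w.2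
      + D.f p.1 * deriv D.f p.1 * (u.1 * D.h p.2 v.2 w.2 + v.1 * D.h p.2 u.2 w.2
        - w.1 * D.h p.2 u.2 v.2) := by
  rw [christoffel, fderiv_metric hp, fderiv_metric hp, fderiv_metric hp, christoffel,
    D.symm_h p.2 w.2 u.2]
  ring

lemma fderiv_christoffel_metric (hp : p ∈ D.domain) (u v z t : ℝ × V) :
    fderiv ℝ (fun q => christoffel D.metric q v z t) p u =
      (1 / 2) * deriv (deriv D.β) p.1 * u.1 * (v.1 * z.1 * t.1)
      + 2 * D.f p.1 * deriv D.f p.1 * u.1 * christoffel D.h p.2 v.2 z.2 t.2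
      + D.f p.1 ^ 2 * fderiv ℝ (fun x => christoffel D.h x v.2 z.2 t.2) p.2 u.2
      + (deriv D.f p.1 ^ 2 + D.f p.1 * deriv (deriv D.f) p.1) * u.1 *
        (v.1 * D.h p.2 z.2 t.2 + z.1 * D.h p.2 v.2 t.2 - t.1 * D.h p.2 v.2 z.2)
      + D.f p.1 * deriv D.f p.1 * (v.1 * fderiv ℝ D.h p.2 u.2 z.2 t.2
        + z.1 * fderiv ℝ D.h p.2 u.2 v.2 t.2 - t.1 * fderiv ℝ D.h p.2 u.2 v.2 z.2) := by
  have he : (fun q => christoffel D.metric q v z t) =ᶠ[𝓝 p] fun q =>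
      (1 / 2) * deriv D.β q.1 * (v.1 * z.1 * t.1)
      + D.f q.1 ^ 2 * christoffel D.h q.2 v.2 z.2 t.2
      + D.f q.1 * deriv D.f q.1 * (v.1 * D.h q.2 z.2 t.2 + z.1 * D.h q.2 v.2 t.2
        - t.1 * D.h q.2 v.2 z.2) := by
    filter_upwards [D.isOpen_domain.mem_nhds hp] with q hq using christoffel_metric hq v z t
  rw [he.fderiv_eq]
  have hβ := hasFDerivAt_base (differentiableAt_of_base D.contDiffOn_deriv_β hp)
  have hf := hasFDerivAt_base (differentiableAt_of_base D.contDiffOn_f hp)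
  have hf' := hasFDerivAt_base (differentiableAt_of_base D.contDiffOn_deriv_f hp)
  have hh := fun a b => hasFDerivAt_fiber (differentiableAt_h_apply hp a b)
  have hΓ := hasFDerivAt_fiber (φ := fun x => christoffel D.h x v.2 z.2 t.2)
    (fderiv_christoffel_apply (contDiffAt_h hp) (differentiableAt_const v.2)
      (differentiableAt_const z.2) (differentiableAt_const t.2)).1
  have h2 := (((hβ.const_mul (1 / 2)).mul_const (v.1 * z.1 * t.1)).add ((hf.pow 2).mul hΓ)).add
    ((hf.mul hf').mul ((((hh z.2 t.2).const_mul v.1).add ((hh v.2 t.2).const_mul z.1)).sub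
      ((hh v.2 z.2).const_mul t.1)))
  have h3 : fderiv ℝ (fun q : ℝ × V => (1 / 2) * deriv D.β q.1 * (v.1 * z.1 * t.1)
      + D.f q.1 ^ 2 * christoffel D.h q.2 v.2 z.2 t.2
      + D.f q.1 * deriv D.f q.1 * (v.1 * D.h q.2 z.2 t.2 + z.1 * D.h q.2 v.2 t.2
        - t.1 * D.h q.2 v.2 z.2)) p = _ := h2.fderiv
  rw [h3]
  simp [fderiv_h_apply hp]
  ring

lemma isInvertible_h {x : V} (hx : x ∈ D.fiber) : (D.h x).IsInvertible :=
  isInvertible_of_nondegenerate (D.nondegenerate_h x hx)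

variable (D) in
/-- The map that raises the last index of the Christoffel symbols of the warped metric. It is also
valid where `f` vanishes: there the second component is multiplied by `f² = 0` in the metric, so the
junk value of `f' / f` is harmless. -/
def sharp (p u v : ℝ × V) : ℝ × V :=
  ((D.β p.1)⁻¹ * ((1 / 2) * deriv D.β p.1 * (u.1 * v.1)
      - D.f p.1 * deriv D.f p.1 * D.h p.2 u.2 v.2),
    christoffelSecond D.h p.2 u.2 v.2 + (deriv D.f p.1 / D.f p.1) • (u.1 • v.2 + v.1 • u.2))

lemma isChristoffelSharp_sharp (hp : p ∈ D.domain) : IsChristoffelSharp D.metric D.sharp p := by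
  intro u v w
  have hs := isChristoffelSharp_christoffelSecond (isInvertible_h hp.2) u.2 v.2 w.2
  have hff : D.f p.1 ^ 2 * (deriv D.f p.1 / D.f p.1) = D.f p.1 * deriv D.f p.1 := by
    rcases eq_or_ne (D.f p.1) 0 with h0 | h0
    · simp [h0]
    · field_simp
  have hβ := D.β_ne_zero p.1 hp.1
  rw [christoffel_metric hp, metric_apply, sharp, ← hs]
  simp only [map_add, map_smul, add_apply, smul_apply, smul_eq_mul]
  have e : D.β p.1 * (((D.β p.1)⁻¹ * ((1 / 2) * deriv D.β p.1 * (u.1 * v.1)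
      - D.f p.1 * deriv D.f p.1 * D.h p.2 u.2 v.2)) * w.1) =
      ((1 / 2) * deriv D.β p.1 * (u.1 * v.1)
        - D.f p.1 * deriv D.f p.1 * D.h p.2 u.2 v.2) * w.1 := by
    field_simp
  rw [e]
  linear_combination (u.1 * D.h p.2 v.2 w.2 + v.1 * D.h p.2 u.2 w.2) * hff

end WarpedModel

/-! ### Metric traces -/

section Trace

/-- The trace `g^{st} Q_{st}` of a bilinear form, computed in any basis, is the trace of the
endomorphism that corresponds to `Q`. -/
lemma sum_inverse_mul_eq_trace {W : Type*} [NormedAddCommGroup W] [NormedSpace ℝ W]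
    [FiniteDimensional ℝ W] {ι : Type*} [Fintype ι] [DecidableEq ι] (c : Module.Basis ι ℝ W)
    (G : W →L[ℝ] W →L[ℝ] ℝ) (hsymm : ∀ v w, G v w = G w v)
    (hG : ∀ v, (∀ w, G v w = 0) → v = 0) (A : W →ₗ[ℝ] W) (Q : W → W → ℝ)
    (hQ : ∀ u v, Q u v = G (A u) v) :
    ∑ s, ∑ t, (Matrix.of fun i j => G (c i) (c j))⁻¹ s t * Q (c s) (c t) =
      LinearMap.trace ℝ W A := by
  -- `N` is the Gram matrix. As `Q` is the product of `N` and the matrix of `A`, the sum is the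
  -- trace of `N⁻¹ N A`.
  set N : Matrix ι ι ℝ := Matrix.of fun i j => G (c i) (c j) with hN
  have hNapp : ∀ i j, N i j = G (c i) (c j) := fun _ _ => rfl
  let Gf : LinearMap.BilinForm ℝ W := LinearMap.mk₂ ℝ (fun v w => G v w) (by simp) (by simp)
    (by simp) (by simp)
  have hdet : N.det ≠ 0 := by
    have hnd : Gf.Nondegenerate := ⟨hG, fun w hw => hG w fun v => by rw [hsymm]; exact hw v⟩
    have := (LinearMap.BilinForm.nondegenerate_iff_det_ne_zero c).1 hnd
    convert this using 2
    ext i j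
    simp [hNapp, LinearMap.BilinForm.toMatrix_apply, Gf]
  have hNt : N.transpose = N := by
    ext i j
    rw [Matrix.transpose_apply, hNapp, hNapp, hsymm]
  have hinv : N⁻¹ * N = 1 := Matrix.nonsing_inv_mul N (isUnit_iff_ne_zero.2 hdet)
  have hrow : ∀ s r, ∑ t, N⁻¹ s t * N r t = if s = r then 1 else 0 := by
    intro s r
    rw [← Matrix.one_apply, ← hinv, Matrix.mul_apply]
    exact Finset.sum_congr rfl fun t _ => by rw [← hNt, Matrix.transpose_apply, hNt]
  have hQ' : ∀ s t, Q (c s) (c t) = ∑ r, c.repr (A (c s)) r * N r t := by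
    intro s t
    rw [hQ]
    conv_lhs => rw [← c.sum_repr (A (c s))]
    simp only [map_sum, sum_apply, map_smul, smul_apply, smul_eq_mul, hNapp]
  rw [LinearMap.trace_eq_matrix_trace ℝ c A, Matrix.trace]
  refine Finset.sum_congr rfl fun s _ => ?_
  simp only [hQ', Finset.mul_sum, Matrix.diag_apply, LinearMap.toMatrix_apply]
  rw [Finset.sum_comm]
  have : ∀ r, ∑ t, N⁻¹ s t * (c.repr (A (c s)) r * N r t) =
      c.repr (A (c s)) r * if s = r then 1 else 0 := by
    intro r
    rw [← hrow, Finset.mul_sum]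
    exact Finset.sum_congr rfl fun t _ => by ring
  simp [this]

lemma trace_prod {V : Type*} [AddCommGroup V] [Module ℝ V] [FiniteDimensional ℝ V]
    (A : ℝ × V →ₗ[ℝ] ℝ × V) :
    LinearMap.trace ℝ (ℝ × V) A = (A (1, 0)).1 +
      LinearMap.trace ℝ V (LinearMap.snd ℝ ℝ V ∘ₗ A ∘ₗ LinearMap.inr ℝ ℝ V) := by
  have hA : A = LinearMap.inl ℝ ℝ V ∘ₗ (LinearMap.fst ℝ ℝ V ∘ₗ A)
      + LinearMap.inr ℝ ℝ V ∘ₗ (LinearMap.snd ℝ ℝ V ∘ₗ A) := by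
    ext <;> simp
  conv_lhs => rw [hA]
  rw [map_add, LinearMap.trace_comp_comm' _ (LinearMap.inl ℝ ℝ V),
    LinearMap.trace_comp_comm' _ (LinearMap.inr ℝ ℝ V), LinearMap.comp_assoc, LinearMap.comp_assoc]
  congr 1
  rw [LinearMap.trace_eq_matrix_trace ℝ (Module.Basis.singleton Unit ℝ)]
  simp [Matrix.trace, LinearMap.toMatrix_apply]

end Trace

/-! ### Curvature of the warped metric in coordinates -/

namespace WarpedModel

variable {V : Type*} [NormedAddCommGroup V] [NormedSpace ℝ V] (D : WarpedModel V)

/-- The second covariant derivative `f'' - (β' / 2β) f'` of the warping function with respect to the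
metric `β dt²` of the base, on the coordinate field. -/
def hess (t : ℝ) : ℝ :=
  deriv (deriv D.f) t - (1 / 2) * deriv D.β t * (D.β t)⁻¹ * deriv D.f t

variable [FiniteDimensional ℝ V]

/-- The tensor on the fibre whose product with `f²` is the vertical part of the curvature of the
warped metric: the curvature of the fibre and a correction of constant curvature type. -/
def fiberCurv (p : ℝ × V) (u v z t : V) : ℝ :=
  curvatureForm D.h p.2 u v z t + deriv D.f p.1 ^ 2 * (D.β p.1)⁻¹ *
    (D.h p.2 u z * D.h p.2 v t - D.h p.2 v z * D.h p.2 u t)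

variable {D} {p : ℝ × V}

/-- The curvature of the warped metric. Both coefficients are smooth across the zeros of `f`. -/
lemma flatRiemann_metric (hp : p ∈ D.domain) (hf : D.f p.1 ≠ 0) (u v z t : ℝ × V) :
    flatRiemann D.metric D.sharp p u v z t = D.f p.1 ^ 2 * D.fiberCurv p u.2 v.2 z.2 t.2
      + D.f p.1 * D.hess p.1 * kulkarniNomizu (fun a b : ℝ × V => a.1 * b.1)
        (fun a b => D.h p.2 a.2 b.2) u v z t := by
  have hsy : ∀ a b c, fderiv ℝ D.h p.2 a b c
      = christoffel D.h p.2 a b c + christoffel D.h p.2 a c b := fun a b c =>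
    (christoffel_add_christoffel (Filter.Eventually.of_forall D.symm_h)
      (differentiableAt_h hp) a b c).symm
  have hs1 : ∀ a b c, D.h p.2 (christoffelSecond D.h p.2 a b) c = christoffel D.h p.2 a b c :=
    isChristoffelSharp_christoffelSecond (isInvertible_h hp.2)
  have hs2 : ∀ a b c, D.h p.2 c (christoffelSecond D.h p.2 a b) = christoffel D.h p.2 a b c :=
    fun a b c => by rw [D.symm_h, hs1]
  have hΓ : ∀ a b c, christoffel D.h p.2 a b c = christoffel D.h p.2 b a c :=
    christoffel_symm (Filter.Eventually.of_forall D.symm_h) (differentiableAt_h hp)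
  have hβ := D.β_ne_zero p.1 hp.1
  -- Writing `f' = f q` turns the claim into a polynomial identity.
  obtain ⟨q, hq⟩ : ∃ q, q = deriv D.f p.1 / D.f p.1 := ⟨_, rfl⟩
  have hfq : deriv D.f p.1 = D.f p.1 * q := by rw [hq]; field_simp
  have hmul : ∀ A B : ℝ, D.β p.1 * ((D.β p.1)⁻¹ * A * ((D.β p.1)⁻¹ * B)) =
      (D.β p.1)⁻¹ * (A * B) := fun A B => by field_simp
  rw [fiberCurv, ← flatRiemann_eq_curvatureForm (contDiffAt_h hp), flatRiemann, flatRiemann,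
    fderiv_christoffel_metric hp, fderiv_christoffel_metric hp, metric_apply, metric_apply]
  simp only [sharp, ← hq, hmul, hess, kulkarniNomizu]
  simp only [map_add, map_smul, add_apply, smul_apply, smul_eq_mul, hsy, hs1, hs2]
  rw [hfq]
  rw [D.symm_h p.2 z.2 v.2, D.symm_h p.2 z.2 t.2, D.symm_h p.2 v.2 u.2, D.symm_h p.2 z.2 u.2,
    hΓ v.2 u.2 t.2, hΓ v.2 u.2 z.2]
  ring

lemma nondegenerate_metric (hp : p ∈ D.domain) (hf : D.f p.1 ≠ 0) (u : ℝ × V)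
    (hu : ∀ v, D.metric p u v = 0) : u = 0 := by
  have h1 := hu (1, 0)
  have h2 : ∀ v : V, D.h p.2 u.2 v = 0 := fun v => by
    have := hu (0, v)
    simpa [metric_apply, hf] using this
  simp [metric_apply, D.β_ne_zero p.1 hp.1] at h1
  exact Prod.ext h1 (D.nondegenerate_h p.2 hp.2 _ h2)

variable (D)

/-- The form `(v, t) ↦ A(u, v, z, t)`, where `A` is the tensor `fiberCurv`. -/
def fiberCurvForm (p : ℝ × V) (u z : V) : V →L[ℝ] V →L[ℝ] ℝ :=
  LinearMap.toContinuousBilinearMap (LinearMap.mk₂ ℝ (fun v t => D.fiberCurv p u v z t)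
    (fun v v' t => by simp only [fiberCurv, curvatureForm, map_add, add_apply]; ring)
    (fun c v t => by
      simp only [fiberCurv, curvatureForm, map_smul, smul_apply, smul_eq_mul]; ring)
    (fun v t t' => by simp only [fiberCurv, curvatureForm, map_add, add_apply]; ring)
    (fun c v t => by
      simp only [fiberCurv, curvatureForm, map_smul, smul_apply, smul_eq_mul]; ring))

lemma fiberCurvForm_apply (p : ℝ × V) (u z v t : V) :
    D.fiberCurvForm p u z v t = D.fiberCurv p u v z t := rfl

/-- The trace of a bilinear form on `V` with respect to the fibre metric. -/
def fiberTrace (x : V) (q : V →L[ℝ] V →L[ℝ] ℝ) : ℝ :=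
  LinearMap.trace ℝ V ((D.h x).inverse.comp q).toLinearMap

lemma fiberTrace_add (x : V) (q q' : V →L[ℝ] V →L[ℝ] ℝ) :
    D.fiberTrace x (q + q') = D.fiberTrace x q + D.fiberTrace x q' := by
  simp [fiberTrace]

lemma fiberTrace_smul (x : V) (c : ℝ) (q : V →L[ℝ] V →L[ℝ] ℝ) :
    D.fiberTrace x (c • q) = c * D.fiberTrace x q := by
  simp [fiberTrace]

/-- The vertical part of the Ricci curvature of the warped metric. -/
def fiberRicci (p : ℝ × V) : V →L[ℝ] V →L[ℝ] ℝ :=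
  LinearMap.toContinuousBilinearMap (LinearMap.mk₂ ℝ
      (fun a b => D.fiberTrace p.2 (D.fiberCurvForm p a b))
    (fun a a' b => by
      rw [← fiberTrace_add]; congr 1; ext v t
      simp only [fiberCurvForm_apply, fiberCurv, curvatureForm, map_add, add_apply]; ring)
    (fun c a b => by
      rw [smul_eq_mul, ← fiberTrace_smul]; congr 1; ext v t
      simp only [fiberCurvForm_apply, fiberCurv, curvatureForm, map_smul, smul_apply,
        smul_eq_mul]; ring)
    (fun a b b' => by
      rw [← fiberTrace_add]; congr 1; ext v t
      simp only [fiberCurvForm_apply, fiberCurv, curvatureForm, map_add, add_apply]; ring)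
    (fun c a b => by
      rw [smul_eq_mul, ← fiberTrace_smul]; congr 1; ext v t
      simp only [fiberCurvForm_apply, fiberCurv, curvatureForm, map_smul, smul_apply,
        smul_eq_mul]; ring))
  + (D.f p.1 * D.hess p.1 * (D.β p.1)⁻¹) • D.h p.2

lemma fiberRicci_apply (p : ℝ × V) (a b : V) :
    D.fiberRicci p a b = D.fiberTrace p.2 (D.fiberCurvForm p a b)
      + D.f p.1 * D.hess p.1 * (D.β p.1)⁻¹ * D.h p.2 a b := rfl

/-- The product of `f²` and the scalar curvature of the warped metric. -/
def scaledScalar (p : ℝ × V) : ℝ :=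
  Module.finrank ℝ V * D.f p.1 * D.hess p.1 * (D.β p.1)⁻¹ + D.fiberTrace p.2 (D.fiberRicci p)

variable {D}

/-- The Ricci curvature of the warped metric: the singular coefficient `m H / f` occurs only at
`dt²`. -/
lemma sum_inverse_mul_flatRiemann (hp : p ∈ D.domain) (hf : D.f p.1 ≠ 0) {ι : Type*} [Fintype ι]
    [DecidableEq ι] (c : Module.Basis ι ℝ (ℝ × V)) (a b : ℝ × V) :
    ∑ s, ∑ t, (Matrix.of fun i j => D.metric p (c i) (c j))⁻¹ s t *
      flatRiemann D.metric D.sharp p a (c s) b (c t) =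
    Module.finrank ℝ V * D.hess p.1 * (D.f p.1)⁻¹ * (a.1 * b.1) + D.fiberRicci p a.2 b.2 := by
  have hβ := D.β_ne_zero p.1 hp.1
  -- The endomorphism `s ↦ R(a, s, b, _)♯`.
  let A : ℝ × V →ₗ[ℝ] ℝ × V :=
    LinearMap.prod
      ((D.f p.1 * D.hess p.1 * (D.β p.1)⁻¹) • (D.h p.2 a.2 b.2 • LinearMap.fst ℝ ℝ V
        - a.1 • ((D.h p.2 b.2).toLinearMap ∘ₗ LinearMap.snd ℝ ℝ V)))
      (((D.h p.2).inverse.comp (D.fiberCurvForm p a.2 b.2)).toLinearMap ∘ₗ LinearMap.snd ℝ ℝ V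
        + (D.hess p.1 * (D.f p.1)⁻¹) • ((a.1 * b.1) • LinearMap.snd ℝ ℝ V
          - b.1 • LinearMap.toSpanSingleton ℝ V a.2 ∘ₗ LinearMap.fst ℝ ℝ V))
  rw [sum_inverse_mul_eq_trace c (D.metric p) (D.metric_symm p) (nondegenerate_metric hp hf) A
    (fun s t => flatRiemann D.metric D.sharp p a s b t), trace_prod]
  · have e : LinearMap.snd ℝ ℝ V ∘ₗ A ∘ₗ LinearMap.inr ℝ ℝ V =
        ((D.h p.2).inverse.comp (D.fiberCurvForm p a.2 b.2)).toLinearMap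
          + (D.hess p.1 * (D.f p.1)⁻¹ * (a.1 * b.1)) • LinearMap.id := by
      ext v
      simp [A, smul_smul]
    rw [e, map_add, map_smul, LinearMap.trace_id, fiberRicci_apply, fiberTrace]
    simp [A]
    ring
  · intro s t
    rw [flatRiemann_metric hp hf, metric_apply]
    have hfc : D.h p.2 ((D.h p.2).inverse (D.fiberCurvForm p a.2 b.2 s.2)) t.2 =
        D.fiberCurv p a.2 s.2 b.2 t.2 := by
      rw [(isInvertible_h hp.2).self_apply_inverse, fiberCurvForm_apply]
    simp [A, hfc, kulkarniNomizu, D.symm_h p.2 b.2 s.2]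
    field_simp
    ring

/-- The scalar curvature of the warped metric has a pole of order at most two at the zeros
of `f`. -/
lemma sum_inverse_mul_ricci (hp : p ∈ D.domain) (hf : D.f p.1 ≠ 0) {ι : Type*} [Fintype ι]
    [DecidableEq ι] (c : Module.Basis ι ℝ (ℝ × V)) :
    ∑ s, ∑ t, (Matrix.of fun i j => D.metric p (c i) (c j))⁻¹ s t *
      (Module.finrank ℝ V * D.hess p.1 * (D.f p.1)⁻¹ * ((c s).1 * (c t).1)
        + D.fiberRicci p (c s).2 (c t).2) = D.scaledScalar p / D.f p.1 ^ 2 := by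
  have hβ := D.β_ne_zero p.1 hp.1
  -- The Ricci endomorphism.
  let A : ℝ × V →ₗ[ℝ] ℝ × V :=
    LinearMap.prod
      ((Module.finrank ℝ V * D.hess p.1 * (D.f p.1)⁻¹ * (D.β p.1)⁻¹) • LinearMap.fst ℝ ℝ V)
      ((D.f p.1 ^ 2)⁻¹ • ((D.h p.2).inverse.comp (D.fiberRicci p)).toLinearMap ∘ₗ
        LinearMap.snd ℝ ℝ V)
  rw [sum_inverse_mul_eq_trace c (D.metric p) (D.metric_symm p) (nondegenerate_metric hp hf) A
    (fun s t => Module.finrank ℝ V * D.hess p.1 * (D.f p.1)⁻¹ * (s.1 * t.1)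
      + D.fiberRicci p s.2 t.2), trace_prod]
  · have e : LinearMap.snd ℝ ℝ V ∘ₗ A ∘ₗ LinearMap.inr ℝ ℝ V =
        (D.f p.1 ^ 2)⁻¹ • ((D.h p.2).inverse.comp (D.fiberRicci p)).toLinearMap := by
      ext v
      simp [A]
    rw [e, map_smul, scaledScalar, fiberTrace]
    simp [A]
    field_simp
  · intro s t
    rw [metric_apply]
    have hfc : D.h p.2 ((D.h p.2).inverse (D.fiberRicci p s.2)) t.2 =
        D.fiberRicci p s.2 t.2 := by
      rw [(isInvertible_h hp.2).self_apply_inverse]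
    simp [A, hfc]
    field_simp

/-! ### Smoothness of the coefficients -/

variable (D)

lemma contDiffOn_inv_β : ContDiffOn ℝ ∞ (fun p : ℝ × V => (D.β p.1)⁻¹) D.domain :=
  (D.contDiffOn_base D.contDiffOn_β).inv fun p hp => D.β_ne_zero p.1 hp.1

lemma contDiffOn_hess : ContDiffOn ℝ ∞ (fun p : ℝ × V => D.hess p.1) D.domain :=
  (D.contDiffOn_base D.contDiffOn_deriv_deriv_f).sub (((contDiffOn_const.mul
    (D.contDiffOn_base D.contDiffOn_deriv_β)).mul D.contDiffOn_inv_β).mul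
    (D.contDiffOn_base D.contDiffOn_deriv_f))

lemma contDiffOn_fiberCurv (u v z t : V) :
    ContDiffOn ℝ ∞ (fun p => D.fiberCurv p u v z t) D.domain := by
  have hh : ∀ a b : V, ContDiffOn ℝ ∞ (fun p : ℝ × V => D.h p.2 a b) D.domain := fun a b =>
    ((D.contDiffOn_fiber D.contDiffOn_h).clm_apply contDiffOn_const).clm_apply contDiffOn_const
  exact (D.contDiffOn_fiber (contDiffOn_curvatureForm D.isOpen_fiber D.contDiffOn_h
    (fun x hx => isInvertible_h hx) u v z t)).add
    ((((D.contDiffOn_base D.contDiffOn_deriv_f).pow 2).mul D.contDiffOn_inv_β).mul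
      (((hh _ _).mul (hh _ _)).sub ((hh _ _).mul (hh _ _))))

lemma contDiffOn_fiberTrace {q : ℝ × V → V →L[ℝ] V →L[ℝ] ℝ} (hq : ContDiffOn ℝ ∞ q D.domain) :
    ContDiffOn ℝ ∞ (fun p => D.fiberTrace p.2 (q p)) D.domain := by
  let L : (V →L[ℝ] V) →L[ℝ] ℝ := LinearMap.toContinuousLinearMap
    (LinearMap.trace ℝ V ∘ₗ ContinuousLinearMap.coeLM ℝ)
  exact L.contDiff.comp_contDiffOn ((D.contDiffOn_fiber (contDiffOn_inverse_metric D.contDiffOn_h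
    fun x hx => isInvertible_h hx)).clm_comp hq)

lemma contDiffOn_fiberRicci : ContDiffOn ℝ ∞ D.fiberRicci D.domain := by
  refine contDiffOn_clm_apply.2 fun a => contDiffOn_clm_apply.2 fun b => ?_
  simp only [fiberRicci_apply]
  refine (D.contDiffOn_fiberTrace ?_).add ((((D.contDiffOn_base D.contDiffOn_f).mul
    D.contDiffOn_hess).mul D.contDiffOn_inv_β).mul
    (((D.contDiffOn_fiber D.contDiffOn_h).clm_apply contDiffOn_const).clm_apply contDiffOn_const))
  refine contDiffOn_clm_apply.2 fun v => contDiffOn_clm_apply.2 fun t => ?_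
  simp only [fiberCurvForm_apply]
  exact D.contDiffOn_fiberCurv a v b t

lemma contDiffOn_scaledScalar : ContDiffOn ℝ ∞ D.scaledScalar D.domain :=
  (((contDiffOn_const.mul (D.contDiffOn_base D.contDiffOn_f)).mul D.contDiffOn_hess).mul
    D.contDiffOn_inv_β).add (D.contDiffOn_fiberTrace D.contDiffOn_fiberRicci)

/-! ### Smooth extension of the contraction and of the parts of the curvature -/

/-- The vector `u_t v + v_t u` of the fibre, where `u_t`, `v_t` are the components along the base.
Its coefficient in `sharp` is the singular function `f' / f`. -/
def mixedPart (u v : ℝ × V) : V := u.1 • v.2 + v.1 • u.2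

/-- The first component of `sharp`, which is smooth. -/
def sharpBase (p u v : ℝ × V) : ℝ :=
  (D.β p.1)⁻¹ * ((1 / 2) * deriv D.β p.1 * (u.1 * v.1) - D.f p.1 * deriv D.f p.1 * D.h p.2 u.2 v.2)

/-- The inner product `⟨a + Γ(u, v), b + Γ(z, w)⟩` of covariant derivatives for the warped metric,
written without division by `f`. -/
def contraction (p a u v b z w : ℝ × V) : ℝ :=
  D.β p.1 * ((a.1 + D.sharpBase p u v) * (b.1 + D.sharpBase p z w))
  + D.f p.1 ^ 2 * D.h p.2 (a.2 + christoffelSecond D.h p.2 u.2 v.2)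
      (b.2 + christoffelSecond D.h p.2 z.2 w.2)
  + D.f p.1 * deriv D.f p.1 * (D.h p.2 (a.2 + christoffelSecond D.h p.2 u.2 v.2) (mixedPart z w)
      + D.h p.2 (mixedPart u v) (b.2 + christoffelSecond D.h p.2 z.2 w.2))
  + deriv D.f p.1 ^ 2 * D.h p.2 (mixedPart u v) (mixedPart z w)

variable {D} {p : ℝ × V}

lemma metric_add_sharp (hf : D.f p.1 ≠ 0) (a u v b z w : ℝ × V) :
    D.metric p (a + D.sharp p u v) (b + D.sharp p z w) = D.contraction p a u v b z w := by
  have h1 : ∀ u v, D.sharp p u v = (D.sharpBase p u v,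
      christoffelSecond D.h p.2 u.2 v.2 + (deriv D.f p.1 / D.f p.1) • mixedPart u v) :=
    fun _ _ => rfl
  rw [contraction, metric_apply, h1, h1]
  simp only [Prod.fst_add, Prod.snd_add, ← add_assoc]
  generalize a.2 + christoffelSecond D.h p.2 u.2 v.2 = A
  generalize b.2 + christoffelSecond D.h p.2 z.2 w.2 = B
  simp only [map_add, map_smul, add_apply, smul_apply, smul_eq_mul]
  field_simp
  ring

lemma contDiffOn_contraction {N : Set (ℝ × V)} (hN : N ⊆ D.domain) {a u v b z w : ℝ × V → ℝ × V}
    (ha : ContDiffOn ℝ ∞ a N) (hu : ContDiffOn ℝ ∞ u N) (hv : ContDiffOn ℝ ∞ v N)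
    (hb : ContDiffOn ℝ ∞ b N) (hz : ContDiffOn ℝ ∞ z N) (hw : ContDiffOn ℝ ∞ w N) :
    ContDiffOn ℝ ∞ (fun p => D.contraction p (a p) (u p) (v p) (b p) (z p) (w p)) N := by
  have hβ := (D.contDiffOn_base D.contDiffOn_β).mono hN
  have hβ' := (D.contDiffOn_base D.contDiffOn_deriv_β).mono hN
  have hi := D.contDiffOn_inv_β.mono hN
  have hf := (D.contDiffOn_base D.contDiffOn_f).mono hN
  have hf' := (D.contDiffOn_base D.contDiffOn_deriv_f).mono hN
  have hh := (D.contDiffOn_fiber D.contDiffOn_h).mono hN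
  have hΓ := (D.contDiffOn_fiber (contDiffOn_christoffelSecond D.isOpen_fiber D.contDiffOn_h
    fun x hx => isInvertible_h hx)).mono hN
  have hm : ∀ {u v : ℝ × V → ℝ × V}, ContDiffOn ℝ ∞ u N → ContDiffOn ℝ ∞ v N →
      ContDiffOn ℝ ∞ (fun p => mixedPart (u p) (v p)) N := fun hu hv =>
    (hu.fst.smul hv.snd).add (hv.fst.smul hu.snd)
  have hs : ∀ {u v : ℝ × V → ℝ × V}, ContDiffOn ℝ ∞ u N → ContDiffOn ℝ ∞ v N →
      ContDiffOn ℝ ∞ (fun p => D.sharpBase p (u p) (v p)) N := fun hu hv =>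
    hi.mul (((contDiffOn_const.mul hβ').mul (hu.fst.mul hv.fst)).sub
      ((hf.mul hf').mul ((hh.clm_apply hu.snd).clm_apply hv.snd)))
  have hA := ha.snd.add ((hΓ.clm_apply hu.snd).clm_apply hv.snd)
  have hB := hb.snd.add ((hΓ.clm_apply hz.snd).clm_apply hw.snd)
  exact (((hβ.mul ((ha.fst.add (hs hu hv)).mul (hb.fst.add (hs hz hw)))).add
    ((hf.pow 2).mul ((hh.clm_apply hA).clm_apply hB))).add
    ((hf.mul hf').mul (((hh.clm_apply hA).clm_apply (hm hz hw)).add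
      ((hh.clm_apply (hm hu hv)).clm_apply hB)))).add
    ((hf'.pow 2).mul ((hh.clm_apply (hm hu hv)).clm_apply (hm hz hw)))

variable (D)

/-- The smooth form whose Kulkarni-Nomizu product with `h` is the scalar part of the curvature of
the warped metric. The dimension of the manifold is `n = 1 + dim V`. -/
def scalarForm (p : ℝ × V) : (ℝ × V) →L[ℝ] (ℝ × V) →L[ℝ] ℝ :=
  (1 / (2 * ((1 + Module.finrank ℝ V : ℕ) : ℝ) * (((1 + Module.finrank ℝ V : ℕ) : ℝ) - 1))
      * D.scaledScalar p) •
    ((2 * D.β p.1) • dtSq + D.f p.1 ^ 2 • vertical (D.h p.2))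

/-- The vertical part of the traceless Ricci curvature of the warped metric, divided by `n - 2`. -/
def tracelessForm (p : ℝ × V) : V →L[ℝ] V →L[ℝ] ℝ :=
  (1 / (((1 + Module.finrank ℝ V : ℕ) : ℝ) - 2)) • (D.fiberRicci p
    - (1 / ((1 + Module.finrank ℝ V : ℕ) : ℝ) * D.scaledScalar p) • D.h p.2)

/-- The product of `f²` and the traceless Ricci curvature of the warped metric, divided by
`n - 2`. -/
def scaledTracelessForm (p : ℝ × V) : (ℝ × V) →L[ℝ] (ℝ × V) →L[ℝ] ℝ :=
  (1 / (((1 + Module.finrank ℝ V : ℕ) : ℝ) - 2)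
    * (Module.finrank ℝ V * D.f p.1 * D.hess p.1
      - 1 / ((1 + Module.finrank ℝ V : ℕ) : ℝ) * D.scaledScalar p * D.β p.1)) • dtSq
    + D.f p.1 ^ 2 • vertical (D.tracelessForm p)

lemma contDiffOn_scalarForm : ContDiffOn ℝ ∞ D.scalarForm D.domain :=
  (contDiffOn_const.mul D.contDiffOn_scaledScalar).smul
    (((contDiffOn_const.mul (D.contDiffOn_base D.contDiffOn_β)).smul contDiffOn_const).add
      (((D.contDiffOn_base D.contDiffOn_f).pow 2).smul
        (contDiffOn_vertical (D.contDiffOn_fiber D.contDiffOn_h))))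

lemma contDiffOn_tracelessForm : ContDiffOn ℝ ∞ D.tracelessForm D.domain :=
  (D.contDiffOn_fiberRicci.sub ((contDiffOn_const.mul D.contDiffOn_scaledScalar).smul
    (D.contDiffOn_fiber D.contDiffOn_h))).const_smul _

lemma contDiffOn_scaledTracelessForm : ContDiffOn ℝ ∞ D.scaledTracelessForm D.domain :=
  ((contDiffOn_const.mul ((((contDiffOn_const.mul (D.contDiffOn_base D.contDiffOn_f)).mul
    D.contDiffOn_hess)).sub ((contDiffOn_const.mul D.contDiffOn_scaledScalar).mul
      (D.contDiffOn_base D.contDiffOn_β)))).smul contDiffOn_const).add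
    (((D.contDiffOn_base D.contDiffOn_f).pow 2).smul
      (contDiffOn_vertical D.contDiffOn_tracelessForm))

variable {D}

/-- In `R g ∘ g` the pole of order two of the scalar curvature is cancelled: since `dt² ∘ dt² = 0`,
the product `g ∘ g` is divisible by `f²`. -/
lemma scalarPart_model (hf : D.f p.1 ≠ 0) (u v z t : ℝ × V) :
    1 / (2 * ((1 + Module.finrank ℝ V : ℕ) : ℝ) * (((1 + Module.finrank ℝ V : ℕ) : ℝ) - 1))
      * (D.scaledScalar p / D.f p.1 ^ 2)
      * kulkarniNomizu (fun a b => D.metric p a b) (fun a b => D.metric p a b) u v z t =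
    kulkarniNomizu (fun a b => D.scalarForm p a b) (fun a b => vertical (D.h p.2) a b)
      u v z t := by
  generalize hc : 1 / (2 * ((1 + Module.finrank ℝ V : ℕ) : ℝ)
    * (((1 + Module.finrank ℝ V : ℕ) : ℝ) - 1)) = c
  simp only [kulkarniNomizu, metric_apply, scalarForm, hc, smul_apply, add_apply,
    smul_eq_mul, dtSq_apply, vertical_apply]
  field_simp
  ring

/-- In `S ∘ g` the poles of the Ricci and the scalar curvature are cancelled: since
`dt² ∘ dt² = 0`, the singular coefficient of `dt²` in `S` only meets the part `f² h` of `g`. -/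
lemma semiTracelessPart_model (hf : D.f p.1 ≠ 0) (u v z t : ℝ × V) :
    1 / (((1 + Module.finrank ℝ V : ℕ) : ℝ) - 2)
      * kulkarniNomizu (fun a b : ℝ × V =>
          Module.finrank ℝ V * D.hess p.1 * (D.f p.1)⁻¹ * (a.1 * b.1) + D.fiberRicci p a.2 b.2
          - 1 / ((1 + Module.finrank ℝ V : ℕ) : ℝ) * (D.scaledScalar p / D.f p.1 ^ 2)
            * D.metric p a b) (fun a b => D.metric p a b) u v z t =
    kulkarniNomizu (fun a b => D.scaledTracelessForm p a b) (fun a b => vertical (D.h p.2) a b)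
      u v z t
    + kulkarniNomizu (fun a b => vertical (D.tracelessForm p) a b)
      (fun a b => (D.β p.1 • dtSq : (ℝ × V) →L[ℝ] (ℝ × V) →L[ℝ] ℝ) a b) u v z t := by
  generalize hc : 1 / (((1 + Module.finrank ℝ V : ℕ) : ℝ) - 2) = c
  generalize hn : 1 / ((1 + Module.finrank ℝ V : ℕ) : ℝ) = n
  simp only [kulkarniNomizu, metric_apply, scaledTracelessForm, tracelessForm, hc, hn, smul_apply,
    add_apply, sub_apply, smul_eq_mul, dtSq_apply, vertical_apply]
  field_simp
  ring

end WarpedModel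

/-! ### Gluing local smooth extensions -/

/-- The Kulkarni-Nomizu product of two bilinear forms, as a tensor of order four. -/
def kulkarniNomizuTensor {V : Type*} [AddCommGroup V] [Module ℝ V] (h k : LinearMap.BilinForm ℝ V) :
    MultilinearMap ℝ (fun _ : Fin 4 => V) ℝ where
  toFun v := kulkarniNomizu (fun a b => h a b) (fun a b => k a b) (v 0) (v 1) (v 2) (v 3)
  map_update_add' {inst} v i x y := by
    obtain rfl : inst = instDecidableEqFin 4 := Subsingleton.elim _ _
    obtain rfl | rfl | rfl | rfl : i = 0 ∨ i = 1 ∨ i = 2 ∨ i = 3 := by revert i; decide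
    all_goals simp [kulkarniNomizu]; ring
  map_update_smul' {inst} v i c x := by
    obtain rfl : inst = instDecidableEqFin 4 := Subsingleton.elim _ _
    obtain rfl | rfl | rfl | rfl : i = 0 ∨ i = 1 ∨ i = 2 ∨ i = 3 := by revert i; decide
    all_goals simp [kulkarniNomizu]; ring

section Gluing

variable {E : Type*} [NormedAddCommGroup E] [NormedSpace ℝ E] [FiniteDimensional ℝ E]
  {H : Type*} [TopologicalSpace H] {I : ModelWithCorners ℝ E H}
  {M : Type*} [TopologicalSpace M] [ChartedSpace H M] [IsManifold I ∞ M]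

/-- Functions that are continuous on an open set are equal there if they agree on a dense set. -/
lemma eqOn_of_dense {U D : Set M} (hU : IsOpen U) (hD : Dense D) {φ ψ : M → ℝ}
    (hφ : ContinuousOn φ U) (hψ : ContinuousOn ψ U) (h : ∀ p ∈ U ∩ D, φ p = ψ p) :
    Set.EqOn φ ψ U := by
  intro p hp
  have hfreq : ∃ᶠ q in 𝓝 p, φ q = ψ q := by
    have h1 : ∃ᶠ q in 𝓝 p, q ∈ U ∩ D :=
      mem_closure_iff_frequently.1 (hD.open_subset_closure_inter hU hp)
    exact h1.mono h
  exact tendsto_nhds_unique_of_frequently_eq (hφ.continuousAt (hU.mem_nhds hp))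
    (hψ.continuousAt (hU.mem_nhds hp)) hfreq

/-- A function on a dense set that extends smoothly near every point of an open set extends smoothly
to the open set: the local extensions are unique. -/
lemma exists_contMDiffOn_of_local {U D : Set M} (hU : IsOpen U) (hD : Dense D) (c : M → ℝ)
    (hloc : ∀ p ∈ U, ∃ N, IsOpen N ∧ p ∈ N ∧ ∃ φ : M → ℝ, ContMDiffOn I 𝓘(ℝ) ∞ φ N ∧
      ∀ q ∈ N ∩ D, φ q = c q) :
    ∃ φ : M → ℝ, ContMDiffOn I 𝓘(ℝ) ∞ φ U ∧ ∀ q ∈ U ∩ D, φ q = c q := by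
  classical
  choose! N hN hpN φ hφ hφc using hloc
  -- The value at each point is taken from the local extension chosen for that point.
  refine ⟨fun p => φ p p, fun p hp => ?_, fun q hq => hφc q hq.1 q ⟨hpN q hq.1, hq.2⟩⟩
  have heq : ∀ q ∈ N p ∩ U, φ q q = φ p q := by
    intro q hq
    have ho : IsOpen (N q ∩ N p) := (hN q hq.2).inter (hN p hp)
    exact eqOn_of_dense ho hD ((hφ q hq.2).continuousOn.mono Set.inter_subset_left)
      ((hφ p hp).continuousOn.mono Set.inter_subset_right)
      (fun r hr => by rw [hφc q hq.2 r ⟨hr.1.1, hr.2⟩, hφc p hp r ⟨hr.1.2, hr.2⟩])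
      ⟨hpN q hq.2, hq.1⟩
  have h1 : ContMDiffAt I 𝓘(ℝ) ∞ (φ p) p := (hφ p hp).contMDiffAt ((hN p hp).mem_nhds (hpN p hp))
  refine (h1.congr_of_eventuallyEq ?_).contMDiffWithinAt
  filter_upwards [((hN p hp).inter hU).mem_nhds ⟨hpN p hp, hp⟩] with q hq using heq q hq

/-- A tensor field of type `(0,4)` is smooth on the open set `N`. -/
def TensorField₄.IsSmoothOn (T : TensorField₄ I M) (N : Set M) : Prop :=
  ∀ U ⊆ N, IsOpen U → ∀ X Y Z W : ∀ p : M, TangentSpace I p,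
    IsSmoothVectorFieldOn I X U → IsSmoothVectorFieldOn I Y U →
    IsSmoothVectorFieldOn I Z U → IsSmoothVectorFieldOn I W U →
    ContMDiffOn I 𝓘(ℝ) ∞ (fun p => T p ![X p, Y p, Z p, W p]) U

/-- The coordinate vector fields form a basis of the tangent space. -/
lemma exists_basis_coordField [I.Boundaryless] {e : OpenPartialHomeomorph M H}
    (he : e ∈ IsManifold.maximalAtlas I ∞ M) {p : M} (hp : p ∈ e.source) {ι : Type*}
    (b : Module.Basis ι ℝ E) :
    ∃ c : Module.Basis ι ℝ (TangentSpace I p), ∀ i, c i = coordField I e b i p := by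
  have hp' : p ∈ (chartParam e he).target := by
    rwa [show (chartParam e he).target = e.source from e.extend_source]
  obtain ⟨x, hx, rfl⟩ : ∃ x ∈ (chartParam e he).source, (chartParam e he) x = p :=
    ⟨(chartParam e he).symm p, (chartParam e he).map_target hp', (chartParam e he).right_inv hp'⟩
  let L := (PartialDiffeomorph.isLocalDiffeomorphAt _ _ _ (chartParam e he)
    hx).mfderivToContinuousLinearEquiv (by simp)
  refine ⟨b.map L.toLinearEquiv, fun i => ?_⟩
  rw [coordField_eq_constField he, constField_param hx]
  exact b.map_apply L.toLinearEquiv i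

lemma exists_basis_fieldInCoord [I.Boundaryless] {W : Type*} [NormedAddCommGroup W]
    [NormedSpace ℝ W] [FiniteDimensional ℝ W] {Ψ : PartialDiffeomorph 𝓘(ℝ, W) I W M ∞} {y : W}
    (hy : y ∈ Ψ.source) {e : OpenPartialHomeomorph M H}
    (he : e ∈ IsManifold.maximalAtlas I ∞ M) (hp : Ψ y ∈ e.source) {ι : Type*}
    (b : Module.Basis ι ℝ E) :
    ∃ c : Module.Basis ι ℝ W, ∀ i, c i = fieldInCoord Ψ (coordField I e b i) y := by
  obtain ⟨c, hc⟩ := exists_basis_coordField he hp b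
  let L := (PartialDiffeomorph.isLocalDiffeomorphAt _ _ _ Ψ hy).mfderivToContinuousLinearEquiv
    (by simp)
  refine ⟨c.map L.symm.toLinearEquiv, fun i => ?_⟩
  refine ((c.map_apply L.symm.toLinearEquiv i).trans (congrArg L.symm (hc i))).trans ?_
  refine (L.symm_apply_eq).2 ?_
  exact (mfderiv_fieldInCoord hy _).symm

/-- A tensor that extends smoothly near every point extends smoothly to the manifold, if the set
where it is given is dense: the local extensions are unique. -/
lemma exists_isSmoothExtension_of_local [I.Boundaryless] {g : BilinField I M}
    (hD : Dense {p : M | (g p).Nondegenerate})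
    (C : OpenPartialHomeomorph M H → Module.Basis (Fin (Module.finrank ℝ E)) ℝ E → M →
      Fin (Module.finrank ℝ E) → Fin (Module.finrank ℝ E) →
      Fin (Module.finrank ℝ E) → Fin (Module.finrank ℝ E) → ℝ)
    (hloc : ∀ p : M, ∃ N, IsOpen N ∧ p ∈ N ∧ ∃ T : TensorField₄ I M, T.IsSmoothOn N ∧
      ∀ e ∈ IsManifold.maximalAtlas I ∞ M, ∀ b, ∀ q ∈ e.source, q ∈ N → (g q).Nondegenerate →
        ∀ i j k l, T q ![coordField I e b i q, coordField I e b j q,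
          coordField I e b k q, coordField I e b l q] = C e b q i j k l) :
    ∃ T : TensorField₄ I M, IsSmoothExtension g C T := by
  choose N hN hpN T hT hTC using hloc
  have heq : ∀ p, ∀ q ∈ N p, T q q = T p q := by
    intro p q hq
    have he := IsManifold.chart_mem_maximalAtlas (I := I) (n := ∞) q
    have hqe := mem_chart_source H q
    set e := chartAt H q
    let b := Module.finBasis ℝ E
    obtain ⟨c, hc⟩ := exists_basis_coordField he hqe b
    refine Module.Basis.ext_multilinear (fun _ => c) fun v => ?_
    have ho : IsOpen (N q ∩ N p ∩ e.source) := ((hN q).inter (hN p)).inter e.open_source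
    have hs := fun a => (isSmoothVectorFieldOn_coordField he b a).mono
      (Set.inter_subset_right (s := N q ∩ N p))
    have hv : (fun i => c (v i)) = ![coordField I e b (v 0) q, coordField I e b (v 1) q,
        coordField I e b (v 2) q, coordField I e b (v 3) q] := by
      ext i
      fin_cases i <;> simp [hc]
    rw [hv]
    exact eqOn_of_dense ho hD
      ((hT q _ (Set.inter_subset_left.trans Set.inter_subset_left) ho _ _ _ _ (hs (v 0)) (hs (v 1))
        (hs (v 2)) (hs (v 3))).continuousOn)
      ((hT p _ (Set.inter_subset_left.trans Set.inter_subset_right) ho _ _ _ _ (hs (v 0)) (hs (v 1))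
        (hs (v 2)) (hs (v 3))).continuousOn)
      (fun r hr => by
        rw [hTC q e he b r hr.1.2 hr.1.1.1 hr.2, hTC p e he b r hr.1.2 hr.1.1.2 hr.2])
      ⟨⟨hpN q, hq⟩, hqe⟩
  refine ⟨fun p => T p p, ?_, fun e he b p hp hnd i j k l => hTC p e he b p hp (hpN p) hnd i j k l⟩
  intro U hU X Y Z W hX hY hZ hW p hp
  have h1 := hT p (N p ∩ U) Set.inter_subset_left ((hN p).inter hU) X Y Z W
    (hX.mono Set.inter_subset_right) (hY.mono Set.inter_subset_right)
    (hZ.mono Set.inter_subset_right) (hW.mono Set.inter_subset_right)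
  have hmem : N p ∩ U ∈ 𝓝 p := ((hN p).inter hU).mem_nhds ⟨hpN p, hp⟩
  refine ((h1.contMDiffAt hmem).congr_of_eventuallyEq ?_).contMDiffWithinAt
  filter_upwards [hmem] with q hq
  rw [heq p q hq.1]

end Gluing

/-! ### Metrics that are locally warped -/

section Local

variable {E : Type*} [NormedAddCommGroup E] [NormedSpace ℝ E] [FiniteDimensional ℝ E]
  {H : Type*} [TopologicalSpace H] {I : ModelWithCorners ℝ E H}
  {M : Type*} [TopologicalSpace M] [ChartedSpace H M] [IsManifold I ∞ M]

section Param

variable {W : Type*} [NormedAddCommGroup W] [NormedSpace ℝ W] [FiniteDimensional ℝ W]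
  {Ψ : PartialDiffeomorph 𝓘(ℝ, W) I W M ∞} {y : W}

lemma contMDiffAt_of_param (hy : y ∈ Ψ.source) {φ : M → ℝ}
    (hφ : ContDiffAt ℝ ∞ (fun x => φ (Ψ x)) y) : ContMDiffAt I 𝓘(ℝ) ∞ φ (Ψ y) := by
  have hinv : Ψ.symm (Ψ y) = y := Ψ.left_inv hy
  have h1 : ContMDiffAt 𝓘(ℝ, W) 𝓘(ℝ) ∞ (fun x => φ (Ψ x)) (Ψ.symm (Ψ y)) := by
    rw [hinv]; exact hφ.contMDiffAt
  have h2 : ContMDiffAt I 𝓘(ℝ, W) ∞ Ψ.symm (Ψ y) :=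
    Ψ.symm.contMDiffOn.contMDiffAt (Ψ.open_target.mem_nhds (Ψ.map_source hy))
  refine (h1.comp _ h2).congr_of_eventuallyEq ?_
  filter_upwards [Ψ.open_target.mem_nhds (Ψ.map_source hy)] with q hq
  exact congrArg φ (Ψ.right_inv hq).symm

/-- To prove that a function is smooth on an open subset of the range of a parametrization, it
suffices to do so in the parametrization. -/
lemma contMDiffOn_of_param {U : Set M} (hU : IsOpen U) (hUΨ : U ⊆ Ψ.target) {φ : M → ℝ} {F : W → ℝ}
    (hF : ContDiffOn ℝ ∞ F (Ψ.source ∩ Ψ ⁻¹' U))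
    (hφ : ∀ x ∈ Ψ.source ∩ Ψ ⁻¹' U, φ (Ψ x) = F x) : ContMDiffOn I 𝓘(ℝ) ∞ φ U := by
  have hopen : IsOpen (Ψ.source ∩ Ψ ⁻¹' U) :=
    Ψ.contMDiffOn.continuousOn.isOpen_inter_preimage Ψ.open_source hU
  intro p hp
  obtain ⟨x, hx, rfl⟩ : ∃ x ∈ Ψ.source, Ψ x = p :=
    ⟨Ψ.symm p, Ψ.map_target (hUΨ hp), Ψ.right_inv (hUΨ hp)⟩
  refine (contMDiffAt_of_param hx ?_).contMDiffWithinAt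
  refine (hF.contDiffAt (hopen.mem_nhds ⟨hx, hp⟩)).congr_of_eventuallyEq ?_
  filter_upwards [hopen.mem_nhds ⟨hx, hp⟩] with z hz using hφ z hz

lemma contDiffOn_fieldInCoord {X : ∀ p : M, TangentSpace I p} {U : Set M}
    (hX : IsSmoothVectorFieldOn I X U) (hU : IsOpen U) :
    ContDiffOn ℝ ∞ (fieldInCoord Ψ X) (Ψ.source ∩ Ψ ⁻¹' U) := fun _ hx =>
  (contDiffAt_fieldInCoord hx.1 hX hU hx.2).contDiffWithinAt

variable (Ψ) in
/-- The field of bilinear forms on `M` that is `Θ` in the parametrization `Ψ`. It is only meaningful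
on the range of `Ψ`. -/
def formField (Θ : W → W →L[ℝ] W →L[ℝ] ℝ) : BilinField I M := fun p =>
  LinearMap.compl₁₂ (ContinuousLinearMap.coeLM ℝ ∘ₗ (Θ (Ψ.symm p)).toLinearMap)
    (mfderiv I 𝓘(ℝ, W) Ψ.symm p).toLinearMap (mfderiv I 𝓘(ℝ, W) Ψ.symm p).toLinearMap

lemma formField_param (hy : y ∈ Ψ.source) (Θ : W → W →L[ℝ] W →L[ℝ] ℝ)
    (X Y : ∀ p : M, TangentSpace I p) :
    formField Ψ Θ (Ψ y) (X (Ψ y)) (Y (Ψ y)) = Θ y (fieldInCoord Ψ X y) (fieldInCoord Ψ Y y) := by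
  have hinv : Ψ.symm (Ψ y) = y := Ψ.left_inv hy
  have h : ∀ X : ∀ p : M, TangentSpace I p,
      mfderiv I 𝓘(ℝ, W) Ψ.symm (Ψ y) (X (Ψ y)) = fieldInCoord Ψ X y := fun X => by
    rw [← mfderiv_fieldInCoord hy X]
    exact mfderiv_symm_param hy _
  change Θ (Ψ.symm (Ψ y)) (mfderiv I 𝓘(ℝ, W) Ψ.symm (Ψ y) (X (Ψ y)))
    (mfderiv I 𝓘(ℝ, W) Ψ.symm (Ψ y) (Y (Ψ y))) = _
  rw [h, h, hinv]

lemma kulkarniNomizuTensor_formField (hy : y ∈ Ψ.source) (Θ Θ' : W → W →L[ℝ] W →L[ℝ] ℝ)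
    (X Y Z T : ∀ p : M, TangentSpace I p) :
    kulkarniNomizuTensor (formField Ψ Θ (Ψ y)) (formField Ψ Θ' (Ψ y))
      ![X (Ψ y), Y (Ψ y), Z (Ψ y), T (Ψ y)] =
    kulkarniNomizu (fun a b => Θ y a b) (fun a b => Θ' y a b) (fieldInCoord Ψ X y)
      (fieldInCoord Ψ Y y) (fieldInCoord Ψ Z y) (fieldInCoord Ψ T y) := by
  change kulkarniNomizu (fun a b => formField Ψ Θ (Ψ y) a b) (fun a b => formField Ψ Θ' (Ψ y) a b)
    (X (Ψ y)) (Y (Ψ y)) (Z (Ψ y)) (T (Ψ y)) = _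
  simp only [kulkarniNomizu, formField_param hy]

variable (Ψ) in
/-- The Kulkarni-Nomizu product of two fields of forms that are given in a parametrization. -/
def kulkarniNomizuField (Θ Θ' : W → W →L[ℝ] W →L[ℝ] ℝ) : TensorField₄ I M := fun p =>
  kulkarniNomizuTensor (formField Ψ Θ p) (formField Ψ Θ' p)

lemma isSmoothOn_kulkarniNomizuField {Θ Θ' : W → W →L[ℝ] W →L[ℝ] ℝ}
    (hΘ : ContDiffOn ℝ ∞ Θ Ψ.source) (hΘ' : ContDiffOn ℝ ∞ Θ' Ψ.source) :
    (kulkarniNomizuField (I := I) Ψ Θ Θ').IsSmoothOn Ψ.target := by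
  intro U hUΨ hU X Y Z T hX hY hZ hT
  have hf : ∀ {Θ : W → W →L[ℝ] W →L[ℝ] ℝ}, ContDiffOn ℝ ∞ Θ Ψ.source →
      ∀ {X Y : ∀ p : M, TangentSpace I p}, IsSmoothVectorFieldOn I X U →
      IsSmoothVectorFieldOn I Y U → ContDiffOn ℝ ∞
        (fun x => Θ x (fieldInCoord Ψ X x) (fieldInCoord Ψ Y x)) (Ψ.source ∩ Ψ ⁻¹' U) :=
    fun hΘ _ _ hX hY => ((hΘ.mono Set.inter_subset_left).clm_apply
      (contDiffOn_fieldInCoord hX hU)).clm_apply (contDiffOn_fieldInCoord hY hU)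
  refine contMDiffOn_of_param hU hUΨ ?_ fun x hx =>
    kulkarniNomizuTensor_formField hx.1 Θ Θ' X Y Z T
  exact (((((hf hΘ hX hZ).mul (hf hΘ' hY hT)).sub ((hf hΘ hX hT).mul (hf hΘ' hY hZ))).add
    ((hf hΘ hY hT).mul (hf hΘ' hX hZ))).sub ((hf hΘ hY hZ).mul (hf hΘ' hX hT)))

lemma TensorField₄.IsSmoothOn.add {T T' : TensorField₄ I M} {N : Set M} (hT : T.IsSmoothOn N)
    (hT' : T'.IsSmoothOn N) : TensorField₄.IsSmoothOn (fun p => T p + T' p) N :=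
  fun U hUN hU X Y Z W hX hY hZ hW =>
    (hT U hUN hU X Y Z W hX hY hZ hW).add (hT' U hUN hU X Y Z W hX hY hZ hW)

end Param

/-- If the metric is non-degenerate on a dense set, it is non-degenerate at the points near which
its signature is constant. -/
lemma IsSignatureRegularPoint.nondegenerate {g : BilinField I M}
    (hsymm : ∀ p : M, ∀ v w : TangentSpace I p, g p v w = g p w v)
    (hD : Dense {p : M | (g p).Nondegenerate}) {p : M} (hp : IsSignatureRegularPoint g p) :
    (g p).Nondegenerate := by
  obtain ⟨q, hqD, hq⟩ := hD.inter_nhds_nonempty hp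
  have hq' : Module.finrank ℝ (LinearMap.range (g q)) = Module.finrank ℝ (LinearMap.range (g p)) :=
    hq
  have : ∀ r : M, FiniteDimensional ℝ (TangentSpace I r) := fun r =>
    inferInstanceAs (FiniteDimensional ℝ E)
  have hrank : ∀ r : M, Module.finrank ℝ (TangentSpace I r) = Module.finrank ℝ E := fun _ => rfl
  have h1 := LinearMap.finrank_range_add_finrank_ker (g q)
  rw [LinearMap.BilinForm.Nondegenerate.ker_eq_bot hqD, finrank_bot, hq', hrank, ← hrank p] at h1
  have h2 := LinearMap.finrank_range_add_finrank_ker (g p)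
  have h3 : LinearMap.ker (g p) = ⊥ := Submodule.finrank_eq_zero.1 (by omega)
  have h4 : ∀ v, (∀ w, g p v w = 0) → v = 0 := fun v hv =>
    LinearMap.ker_eq_bot'.1 h3 v (LinearMap.ext hv)
  exact ⟨h4, fun w hw => h4 w fun v => by rw [hsymm]; exact hw v⟩

section Warped

variable {V : Type*} [NormedAddCommGroup V] [NormedSpace ℝ V] [FiniteDimensional ℝ V]
  {g : BilinField I M} {Ψ : PartialDiffeomorph 𝓘(ℝ, ℝ × V) I (ℝ × V) M ∞} {D : WarpedModel V}
  {y : ℝ × V}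

/-- In the parametrization `Ψ`, the metric `g` is the warped metric of the model `D`, and the
warping function of `D` does not vanish where `g` is non-degenerate. This last condition only
excludes zeros of the warping function when the fibre has dimension zero. -/
structure IsWarpedParam (g : BilinField I M) (Ψ : PartialDiffeomorph 𝓘(ℝ, ℝ × V) I (ℝ × V) M ∞)
    (D : WarpedModel V) : Prop where
  source_subset : Ψ.source ⊆ D.domain
  metric_eq : ∀ y ∈ Ψ.source, metricInCoord Ψ g y = D.metric y
  f_ne_zero : ∀ y ∈ Ψ.source, (g (Ψ y)).Nondegenerate → D.f y.1 ≠ 0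

namespace IsWarpedParam

lemma eventuallyEq (hW : IsWarpedParam g Ψ D) (hy : y ∈ Ψ.source) :
    metricInCoord Ψ g =ᶠ[𝓝 y] D.metric := by
  filter_upwards [Ψ.open_source.mem_nhds hy] with x hx using hW.metric_eq x hx

lemma christoffel_eq (hW : IsWarpedParam g Ψ D) (hy : y ∈ Ψ.source) (u v w : ℝ × V) :
    christoffel (metricInCoord Ψ g) y u v w = christoffel D.metric y u v w := by
  rw [christoffel, christoffel, (hW.eventuallyEq hy).fderiv_eq]

lemma isChristoffelSharp (hW : IsWarpedParam g Ψ D) (hy : y ∈ Ψ.source) :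
    IsChristoffelSharp (metricInCoord Ψ g) D.sharp y := fun u v w => by
  rw [hW.christoffel_eq hy, hW.metric_eq y hy]
  exact WarpedModel.isChristoffelSharp_sharp (hW.source_subset hy) u v w

lemma flatRiemann_eq (hW : IsWarpedParam g Ψ D) (hy : y ∈ Ψ.source) (u v z t : ℝ × V) :
    flatRiemann (metricInCoord Ψ g) D.sharp y u v z t = flatRiemann D.metric D.sharp y u v z t := by
  have h : ∀ a b c : ℝ × V, (fun x => christoffel (metricInCoord Ψ g) x a b c) =ᶠ[𝓝 y]
      fun x => christoffel D.metric x a b c := fun a b c => by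
    filter_upwards [Ψ.open_source.mem_nhds hy] with x hx using hW.christoffel_eq hx a b c
  rw [flatRiemann, flatRiemann, (h _ _ _).fderiv_eq, (h _ _ _).fderiv_eq, hW.metric_eq y hy]

lemma contMDiffOn_metric (hW : IsWarpedParam g Ψ D) {U : Set M} (hU : IsOpen U)
    (hUΨ : U ⊆ Ψ.target) {X Y : ∀ p : M, TangentSpace I p} (hX : IsSmoothVectorFieldOn I X U)
    (hY : IsSmoothVectorFieldOn I Y U) :
    ContMDiffOn I 𝓘(ℝ) ∞ (fun p => g p (X p) (Y p)) U := by
  refine contMDiffOn_of_param hU hUΨ (F := fun x => D.metric x (fieldInCoord Ψ X x)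
    (fieldInCoord Ψ Y x)) ?_ fun x hx => ?_
  · exact ((D.contDiffOn_metric.mono (Set.inter_subset_left.trans hW.source_subset)).clm_apply
      (contDiffOn_fieldInCoord hX hU)).clm_apply (contDiffOn_fieldInCoord hY hU)
  · rw [← hW.metric_eq x hx.1, metricInCoord_fieldInCoord hx.1]

/-- The contraction extends smoothly over the range of the parametrization. -/
lemma exists_contraction (hW : IsWarpedParam g Ψ D) (hg : IsSingularMetric g) {U : Set M}
    (hU : IsOpen U) (hUΨ : U ⊆ Ψ.target) {X Y Z T : ∀ p : M, TangentSpace I p}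
    (hX : IsSmoothVectorFieldOn I X U) (hY : IsSmoothVectorFieldOn I Y U)
    (hZ : IsSmoothVectorFieldOn I Z U) (hT : IsSmoothVectorFieldOn I T U) :
    ∃ φ : M → ℝ, ContMDiffOn I 𝓘(ℝ) ∞ φ U ∧
      ∀ q ∈ U, (g q).Nondegenerate → φ q = koszulContraction g X Y Z T q := by
  let F : ℝ × V → ℝ := fun x => D.contraction x
    (fderiv ℝ (fieldInCoord Ψ Y) x (fieldInCoord Ψ X x)) (fieldInCoord Ψ X x) (fieldInCoord Ψ Y x)
    (fderiv ℝ (fieldInCoord Ψ T) x (fieldInCoord Ψ Z x)) (fieldInCoord Ψ Z x) (fieldInCoord Ψ T x)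
  have hopen : IsOpen (Ψ.source ∩ Ψ ⁻¹' U) :=
    Ψ.contMDiffOn.continuousOn.isOpen_inter_preimage Ψ.open_source hU
  have hc : ∀ {X : ∀ p : M, TangentSpace I p}, IsSmoothVectorFieldOn I X U →
      ContDiffOn ℝ ∞ (fieldInCoord Ψ X) (Ψ.source ∩ Ψ ⁻¹' U) := fun hX =>
    contDiffOn_fieldInCoord hX hU
  have hd : ∀ {X Y : ∀ p : M, TangentSpace I p}, IsSmoothVectorFieldOn I X U →
      IsSmoothVectorFieldOn I Y U → ContDiffOn ℝ ∞
        (fun x => fderiv ℝ (fieldInCoord Ψ Y) x (fieldInCoord Ψ X x)) (Ψ.source ∩ Ψ ⁻¹' U) :=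
    fun hX hY => ((hc hY).fderiv_of_isOpen hopen (m := ∞) (by simp)).clm_apply (hc hX)
  have hF : ContDiffOn ℝ ∞ F (Ψ.source ∩ Ψ ⁻¹' U) :=
    WarpedModel.contDiffOn_contraction (Set.inter_subset_left.trans hW.source_subset)
      (hd hX hY) (hc hX) (hc hY) (hd hZ hT) (hc hZ) (hc hT)
  refine ⟨fun p => F (Ψ.symm p), contMDiffOn_of_param hU hUΨ hF fun x hx => ?_,
    fun q hq hnd => ?_⟩
  · exact congrArg F (Ψ.left_inv hx.1)
  · obtain ⟨x, hx, rfl⟩ : ∃ x ∈ Ψ.source, Ψ x = q :=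
      ⟨Ψ.symm q, Ψ.map_target (hUΨ hq), Ψ.right_inv (hUΨ hq)⟩
    rw [koszulContraction_param hg hx hU hq hX hY hZ hT (hW.isChristoffelSharp hx),
      hW.metric_eq x hx]
    exact (congrArg F (Ψ.left_inv hx)).trans
      (WarpedModel.metric_add_sharp (hW.f_ne_zero x hx hnd) _ _ _ _ _ _).symm

variable [I.Boundaryless] {e : OpenPartialHomeomorph M H}
  {ι : Type*} [Fintype ι] [DecidableEq ι]

lemma metricComp_eq (hW : IsWarpedParam g Ψ D) (hy : y ∈ Ψ.source) (b : Module.Basis ι ℝ E)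
    (i j : ι) : metricComp g e b (Ψ y) i j = D.metric y (fieldInCoord Ψ (coordField I e b i) y)
      (fieldInCoord Ψ (coordField I e b j) y) := by
  rw [← hW.metric_eq y hy, metricInCoord_fieldInCoord hy, metricComp]

lemma ricci_eq (hW : IsWarpedParam g Ψ D) (hg : IsSingularMetric g) (hy : y ∈ Ψ.source)
    (hf : D.f y.1 ≠ 0) (he : e ∈ IsManifold.maximalAtlas I ∞ M) (hye : Ψ y ∈ e.source)
    (b : Module.Basis ι ℝ E) (i j : ι) :
    ricci g e b (Ψ y) i j =
      Module.finrank ℝ V * D.hess y.1 * (D.f y.1)⁻¹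
        * ((fieldInCoord Ψ (coordField I e b i) y).1 * (fieldInCoord Ψ (coordField I e b j) y).1)
      + D.fiberRicci y (fieldInCoord Ψ (coordField I e b i) y).2
          (fieldInCoord Ψ (coordField I e b j) y).2 := by
  obtain ⟨c, hc⟩ := exists_basis_fieldInCoord hy he hye b
  rw [← WarpedModel.sum_inverse_mul_flatRiemann (hW.source_subset hy) hf c]
  simp only [ricci, inverseMetricComp, riemann_param hg hy he hye b (hW.isChristoffelSharp hy),
    hW.flatRiemann_eq hy, hc]
  have : (Matrix.of (metricComp g e b (Ψ y))) = Matrix.of fun i j =>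
      D.metric y (fieldInCoord Ψ (coordField I e b i) y)
        (fieldInCoord Ψ (coordField I e b j) y) := by
    ext i j
    exact hW.metricComp_eq hy b i j
  rw [this]

lemma scalarCurvature_eq (hW : IsWarpedParam g Ψ D) (hg : IsSingularMetric g) (hy : y ∈ Ψ.source)
    (hf : D.f y.1 ≠ 0) (he : e ∈ IsManifold.maximalAtlas I ∞ M) (hye : Ψ y ∈ e.source)
    (b : Module.Basis ι ℝ E) :
    scalarCurvature g e b (Ψ y) = D.scaledScalar y / D.f y.1 ^ 2 := by
  obtain ⟨c, hc⟩ := exists_basis_fieldInCoord hy he hye b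
  rw [← WarpedModel.sum_inverse_mul_ricci (hW.source_subset hy) hf c]
  simp only [scalarCurvature, inverseMetricComp, hW.ricci_eq hg hy hf he hye, hc]
  have : (Matrix.of (metricComp g e b (Ψ y))) = Matrix.of fun i j =>
      D.metric y (fieldInCoord Ψ (coordField I e b i) y)
        (fieldInCoord Ψ (coordField I e b j) y) := by
    ext i j
    exact hW.metricComp_eq hy b i j
  rw [this]

lemma scalarPart_eq (hW : IsWarpedParam g Ψ D) (hg : IsSingularMetric g) (hy : y ∈ Ψ.source)
    (hf : D.f y.1 ≠ 0) (he : e ∈ IsManifold.maximalAtlas I ∞ M) (hye : Ψ y ∈ e.source)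
    (b : Module.Basis ι ℝ E) (hι : Fintype.card ι = 1 + Module.finrank ℝ V) (i j k l : ι) :
    kulkarniNomizuField Ψ D.scalarForm (fun x => WarpedModel.vertical (D.h x.2)) (Ψ y)
      ![coordField I e b i (Ψ y), coordField I e b j (Ψ y), coordField I e b k (Ψ y),
        coordField I e b l (Ψ y)] = scalarPart g e b (Ψ y) i j k l := by
  rw [kulkarniNomizuField, kulkarniNomizuTensor_formField hy, ← WarpedModel.scalarPart_model hf,
    scalarPart, hW.scalarCurvature_eq hg hy hf he hye, hι]
  simp only [kulkarniNomizu, hW.metricComp_eq hy]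

lemma semiTracelessPart_eq (hW : IsWarpedParam g Ψ D) (hg : IsSingularMetric g)
    (hy : y ∈ Ψ.source) (hf : D.f y.1 ≠ 0) (he : e ∈ IsManifold.maximalAtlas I ∞ M)
    (hye : Ψ y ∈ e.source) (b : Module.Basis ι ℝ E)
    (hι : Fintype.card ι = 1 + Module.finrank ℝ V) (i j k l : ι) :
    (kulkarniNomizuField Ψ D.scaledTracelessForm (fun x => WarpedModel.vertical (D.h x.2)) (Ψ y)
      + kulkarniNomizuField Ψ (fun x => WarpedModel.vertical (D.tracelessForm x))
        (fun x => D.β x.1 • WarpedModel.dtSq) (Ψ y))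
      ![coordField I e b i (Ψ y), coordField I e b j (Ψ y), coordField I e b k (Ψ y),
        coordField I e b l (Ψ y)] = semiTracelessPart g e b (Ψ y) i j k l := by
  rw [add_apply, kulkarniNomizuField, kulkarniNomizuField,
    kulkarniNomizuTensor_formField hy, kulkarniNomizuTensor_formField hy,
    ← WarpedModel.semiTracelessPart_model hf, semiTracelessPart, hι]
  simp only [kulkarniNomizu, tracelessRicci, hW.metricComp_eq hy,
    hW.scalarCurvature_eq hg hy hf he hye, hW.ricci_eq hg hy hf he hye, hι]

end IsWarpedParam

variable (V) in
/-- A metric that is locally a degenerate warped product with one-dimensional base is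
quasi-regular. -/
theorem isQuasiRegular_of_locally_warped [I.Boundaryless]
    (hdim : Module.finrank ℝ E = 1 + Module.finrank ℝ V)
    (hsymm : ∀ p : M, ∀ v w : TangentSpace I p, g p v w = g p w v)
    (hdense : Dense {p : M | (g p).Nondegenerate})
    (hloc : ∀ p : M, ∃ (Ψ : PartialDiffeomorph 𝓘(ℝ, ℝ × V) I (ℝ × V) M ∞) (D : WarpedModel V),
      p ∈ Ψ.target ∧ IsWarpedParam g Ψ D) : IsQuasiRegular g := by
  have hι : Fintype.card (Fin (Module.finrank ℝ E)) = 1 + Module.finrank ℝ V := by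
    rw [Fintype.card_fin, hdim]
  have hg : IsSingularMetric g := by
    refine ⟨hsymm, fun U hU X Y hX hY p hp => ?_⟩
    obtain ⟨Ψ, D, hpΨ, hW⟩ := hloc p
    exact ((hW.contMDiffOn_metric (hU.inter Ψ.open_target) Set.inter_subset_right
      (hX.mono Set.inter_subset_left) (hY.mono Set.inter_subset_left)).contMDiffAt
      ((hU.inter Ψ.open_target).mem_nhds ⟨hp, hpΨ⟩)).contMDiffWithinAt
  have hpoint : ∀ {Ψ : PartialDiffeomorph 𝓘(ℝ, ℝ × V) I (ℝ × V) M ∞} {p : M}, p ∈ Ψ.target →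
      ∃ y ∈ Ψ.source, Ψ y = p := fun {Ψ p} hp => ⟨Ψ.symm p, Ψ.map_target hp, Ψ.right_inv hp⟩
  refine { toIsSingularMetric := hg, koszul_mem_flat := ?_, contraction_smooth := ?_,
           dense_nondegenerate := hdense, scalarPart_extends := ?_,
           semiTracelessPart_extends := ?_ }
  · intro U hU X Y hX hY p hp
    obtain ⟨Ψ, D, hpΨ, hW⟩ := hloc p
    obtain ⟨y, hy, rfl⟩ := hpoint hpΨ
    exact ⟨_, representsKoszul_param hg hy hU hp hX hY (hW.isChristoffelSharp hy)⟩
  · intro U hU X Y Z T hX hY hZ hT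
    obtain ⟨φ, hφ, hφc⟩ := exists_contMDiffOn_of_local (I := I) hU hdense
      (koszulContraction g X Y Z T) fun p hp => by
        obtain ⟨Ψ, D, hpΨ, hW⟩ := hloc p
        obtain ⟨φ, hφ, hφc⟩ := hW.exists_contraction hg (hU.inter Ψ.open_target)
          Set.inter_subset_right (hX.mono Set.inter_subset_left) (hY.mono Set.inter_subset_left)
          (hZ.mono Set.inter_subset_left) (hT.mono Set.inter_subset_left)
        exact ⟨_, hU.inter Ψ.open_target, ⟨hp, hpΨ⟩, φ, hφ, fun q hq => hφc q hq.1 hq.2⟩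
    exact ⟨φ, hφ, fun p hp hreg => hφc p ⟨hp, hreg.nondegenerate hsymm hdense⟩⟩
  · refine exists_isSmoothExtension_of_local hdense _ fun p => ?_
    obtain ⟨Ψ, D, hpΨ, hW⟩ := hloc p
    refine ⟨Ψ.target, Ψ.open_target, hpΨ,
      kulkarniNomizuField Ψ D.scalarForm (fun x => WarpedModel.vertical (D.h x.2)),
      isSmoothOn_kulkarniNomizuField (D.contDiffOn_scalarForm.mono hW.source_subset)
        ((WarpedModel.contDiffOn_vertical (D.contDiffOn_fiber D.contDiffOn_h)).mono
          hW.source_subset), fun e he b q hqe hq hnd i j k l => ?_⟩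
    obtain ⟨y, hy, rfl⟩ := hpoint hq
    exact hW.scalarPart_eq hg hy (hW.f_ne_zero y hy hnd) he hqe b hι i j k l
  · refine exists_isSmoothExtension_of_local hdense _ fun p => ?_
    obtain ⟨Ψ, D, hpΨ, hW⟩ := hloc p
    refine ⟨Ψ.target, Ψ.open_target, hpΨ, _,
      (isSmoothOn_kulkarniNomizuField (D.contDiffOn_scaledTracelessForm.mono hW.source_subset)
        ((WarpedModel.contDiffOn_vertical (D.contDiffOn_fiber D.contDiffOn_h)).mono
          hW.source_subset)).add
      (isSmoothOn_kulkarniNomizuField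
        ((WarpedModel.contDiffOn_vertical D.contDiffOn_tracelessForm).mono hW.source_subset)
        (((D.contDiffOn_base D.contDiffOn_β).smul
          (contDiffOn_const (c := WarpedModel.dtSq (V := V)))).mono hW.source_subset)),
      fun e he b q hqe hq hnd i j k l => ?_⟩
    obtain ⟨y, hy, rfl⟩ := hpoint hq
    exact hW.semiTracelessPart_eq hg hy (hW.f_ne_zero y hy hnd) he hqe b hι i j k l

end Warped

end Local

/-! ### Parametrizations of a warped product -/

section Product

variable {EB : Type*} [NormedAddCommGroup EB] [NormedSpace ℝ EB] [FiniteDimensional ℝ EB]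
  {HB : Type*} [TopologicalSpace HB] {IB : ModelWithCorners ℝ EB HB}
  {B : Type*} [TopologicalSpace B] [ChartedSpace HB B] [IsManifold IB ∞ B]
  {EF : Type*} [NormedAddCommGroup EF] [NormedSpace ℝ EF] [FiniteDimensional ℝ EF]
  {HF : Type*} [TopologicalSpace HF] {IF : ModelWithCorners ℝ EF HF}
  {F : Type*} [TopologicalSpace F] [ChartedSpace HF F] [IsManifold IF ∞ F]
  (ΨB : PartialDiffeomorph 𝓘(ℝ) IB ℝ B ∞) (ΨF : PartialDiffeomorph 𝓘(ℝ, EF) IF EF F ∞)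

/-- The product of parametrizations of the base and of the fibre. -/
def prodParam : PartialDiffeomorph 𝓘(ℝ, ℝ × EF) (IB.prod IF) (ℝ × EF) (B × F) ∞ where
  toPartialEquiv := ΨB.toPartialEquiv.prod ΨF.toPartialEquiv
  open_source := ΨB.open_source.prod ΨF.open_source
  open_target := ΨB.open_target.prod ΨF.open_target
  contMDiffOn_toFun :=
    (ΨB.contMDiffOn.comp (contDiff_fst.contMDiff.contMDiffOn) fun _ hp => hp.1).prodMk
      (ΨF.contMDiffOn.comp (contDiff_snd.contMDiff.contMDiffOn) fun _ hp => hp.2)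
  contMDiffOn_invFun :=
    (ΨB.symm.contMDiffOn.comp contMDiffOn_fst fun _ hp => hp.1).prodMk_space
      (ΨF.symm.contMDiffOn.comp contMDiffOn_snd fun _ hp => hp.2)

variable {ΨB ΨF} {y : ℝ × EF}

lemma mfderiv_fst_prodParam (hy : y ∈ (prodParam ΨB ΨF).source) (u : ℝ × EF) :
    mfderiv (IB.prod IF) IB Prod.fst (prodParam ΨB ΨF y)
      (mfderiv 𝓘(ℝ, ℝ × EF) (IB.prod IF) (prodParam ΨB ΨF) y u) =
    mfderiv 𝓘(ℝ) IB ΨB y.1 u.1 := by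
  have h1 := mfderiv_comp y (mdifferentiableAt_fst (I := IB) (I' := IF))
    (mdifferentiableAt_param hy)
  have h2 := mfderiv_comp (I := 𝓘(ℝ, ℝ × EF)) y (mdifferentiableAt_param (Ψ := ΨB) hy.1)
    (differentiableAt_fst (𝕜 := ℝ) (E := ℝ) (F := EF) (p := y)).mdifferentiableAt
  have h3 : (Prod.fst ∘ prodParam ΨB ΨF : ℝ × EF → B) = ΨB ∘ Prod.fst := rfl
  rw [h3] at h1
  have h4 := congrArg (fun A => A u) (h1.symm.trans h2)
  refine h4.trans ?_
  have h5 : mfderiv 𝓘(ℝ, ℝ × EF) 𝓘(ℝ) Prod.fst y = ContinuousLinearMap.fst ℝ ℝ EF := by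
    rw [mfderiv_eq_fderiv]; exact fderiv_fst
  change mfderiv 𝓘(ℝ) IB ΨB y.1 (mfderiv 𝓘(ℝ, ℝ × EF) 𝓘(ℝ) Prod.fst y u) = _
  rw [h5]
  rfl

lemma mfderiv_snd_prodParam (hy : y ∈ (prodParam ΨB ΨF).source) (u : ℝ × EF) :
    mfderiv (IB.prod IF) IF Prod.snd (prodParam ΨB ΨF y)
      (mfderiv 𝓘(ℝ, ℝ × EF) (IB.prod IF) (prodParam ΨB ΨF) y u) =
    mfderiv 𝓘(ℝ, EF) IF ΨF y.2 u.2 := by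
  have h1 := mfderiv_comp y (mdifferentiableAt_snd (I := IB) (I' := IF))
    (mdifferentiableAt_param hy)
  have h2 := mfderiv_comp (I := 𝓘(ℝ, ℝ × EF)) y (mdifferentiableAt_param (Ψ := ΨF) hy.2)
    (differentiableAt_snd (𝕜 := ℝ) (E := ℝ) (F := EF) (p := y)).mdifferentiableAt
  have h3 : (Prod.snd ∘ prodParam ΨB ΨF : ℝ × EF → F) = ΨF ∘ Prod.snd := rfl
  rw [h3] at h1
  have h4 := congrArg (fun A => A u) (h1.symm.trans h2)
  refine h4.trans ?_
  have h5 : mfderiv 𝓘(ℝ, ℝ × EF) 𝓘(ℝ, EF) Prod.snd y = ContinuousLinearMap.snd ℝ ℝ EF := by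
    rw [mfderiv_eq_fderiv]; exact fderiv_snd
  change mfderiv 𝓘(ℝ, EF) IF ΨF y.2 (mfderiv 𝓘(ℝ, ℝ × EF) 𝓘(ℝ, EF) Prod.snd y u) = _
  rw [h5]
  rfl

lemma metricInCoord_warpedProduct (gB : BilinField IB B) (gF : BilinField IF F) (f : B → ℝ)
    (hy : y ∈ (prodParam ΨB ΨF).source) (u v : ℝ × EF) :
    metricInCoord (prodParam ΨB ΨF) (warpedProduct gB gF f) y u v =
      metricInCoord ΨB gB y.1 u.1 v.1 + f (ΨB y.1) ^ 2 * metricInCoord ΨF gF y.2 u.2 v.2 := by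
  rw [metricInCoord_apply, metricInCoord_apply, metricInCoord_apply,
    ← mfderiv_fst_prodParam hy, ← mfderiv_fst_prodParam hy, ← mfderiv_snd_prodParam hy,
    ← mfderiv_snd_prodParam hy]
  rfl

lemma nondegenerate_metricInCoord {E : Type*} [NormedAddCommGroup E] [NormedSpace ℝ E]
    [FiniteDimensional ℝ E] {H : Type*} [TopologicalSpace H] {I : ModelWithCorners ℝ E H}
    {M : Type*} [TopologicalSpace M] [ChartedSpace H M] [IsManifold I ∞ M]
    {W : Type*} [NormedAddCommGroup W] [NormedSpace ℝ W] [FiniteDimensional ℝ W]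
    {Ψ : PartialDiffeomorph 𝓘(ℝ, W) I W M ∞} {g : BilinField I M} {x : W} (hx : x ∈ Ψ.source)
    (hg : (g (Ψ x)).Nondegenerate) (v : W) (hv : ∀ w, metricInCoord Ψ g x v w = 0) : v = 0 := by
  have hinv := isInvertible_mfderiv_param hx
  have h : mfderiv 𝓘(ℝ, W) I Ψ x v = 0 := hg.1 _ fun w => by
    obtain ⟨w', rfl⟩ : ∃ w' : W, mfderiv 𝓘(ℝ, W) I Ψ x w' = w := hinv.surjective w
    exact hv w'
  exact hinv.injective (h.trans (map_zero _).symm)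

/-- The model of a warped product in a product parametrization. -/
def warpedModel {gB : BilinField IB B} (hgB : IsSemiRiemannianMetric gB) {gF : BilinField IF F}
    (hgF : IsSemiRiemannianMetric gF) {f : B → ℝ} (hf : ContMDiff IB 𝓘(ℝ) ∞ f)
    (ΨB : PartialDiffeomorph 𝓘(ℝ) IB ℝ B ∞) (ΨF : PartialDiffeomorph 𝓘(ℝ, EF) IF EF F ∞) :
    WarpedModel EF where
  base := ΨB.source
  fiber := ΨF.source
  β t := metricInCoord ΨB gB t 1 1
  f t := f (ΨB t)
  h := metricInCoord ΨF gF
  isOpen_base := ΨB.open_source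
  isOpen_fiber := ΨF.open_source
  contDiffOn_β := ((contDiffOn_metricInCoord ΨB hgB.toIsSingularMetric).clm_apply
    contDiffOn_const).clm_apply contDiffOn_const
  contDiffOn_f := contDiffOn_comp_param hf.contMDiffOn
  contDiffOn_h := contDiffOn_metricInCoord ΨF hgF.toIsSingularMetric
  β_ne_zero t ht h0 := one_ne_zero (nondegenerate_metricInCoord ht (hgB.nondegenerate _) (1 : ℝ)
    fun w => by rw [← mul_one w, ← smul_eq_mul, map_smul, h0, smul_zero])
  symm_h := metricInCoord_symm ΨF hgF.toIsSingularMetric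
  nondegenerate_h x hx := nondegenerate_metricInCoord hx (hgF.nondegenerate _)

lemma isWarpedParam_prodParam {gB : BilinField IB B} (hgB : IsSemiRiemannianMetric gB)
    {gF : BilinField IF F} (hgF : IsSemiRiemannianMetric gF) {f : B → ℝ}
    (hf : ContMDiff IB 𝓘(ℝ) ∞ f)
    (hf0 : ∀ p : B × F, (warpedProduct gB gF f p).Nondegenerate → f p.1 ≠ 0) :
    IsWarpedParam (warpedProduct gB gF f) (prodParam ΨB ΨF) (warpedModel hgB hgF hf ΨB ΨF) where
  source_subset := subset_rfl
  metric_eq y hy := by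
    refine ContinuousLinearMap.ext fun u => ContinuousLinearMap.ext fun v => ?_
    rw [metricInCoord_warpedProduct gB gF f hy, WarpedModel.metric_apply]
    have h : metricInCoord ΨB gB y.1 u.1 v.1 = metricInCoord ΨB gB y.1 1 1 * (u.1 * v.1) := by
      conv_lhs => rw [← mul_one u.1, ← mul_one v.1, ← smul_eq_mul, ← smul_eq_mul v.1, map_smul,
        map_smul, smul_apply, smul_eq_mul, smul_eq_mul]
      ring
    rw [h]
    rfl
  f_ne_zero y _ hnd := hf0 _ hnd

lemma warpedProduct_apply (gB : BilinField IB B) (gF : BilinField IF F) (f : B → ℝ) (p : B × F)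
    (v w : TangentSpace (IB.prod IF) p) :
    warpedProduct gB gF f p v w = gB p.1 v.1 w.1 + f p.1 ^ 2 * gF p.2 v.2 w.2 := by
  simp only [warpedProduct, mfderiv_fst, mfderiv_snd]
  rfl

lemma warpedProduct_symm {gB : BilinField IB B} (hgB : IsSemiRiemannianMetric gB)
    {gF : BilinField IF F} (hgF : IsSemiRiemannianMetric gF) (f : B → ℝ) (p : B × F)
    (v w : TangentSpace (IB.prod IF) p) :
    warpedProduct gB gF f p v w = warpedProduct gB gF f p w v :=
  (warpedProduct_apply gB gF f p v w).trans <|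
    (congrArg₂ (fun r s => r + f p.1 ^ 2 * s) (hgB.symm p.1 _ _) (hgF.symm p.2 _ _)).trans
      (warpedProduct_apply gB gF f p w v).symm

lemma nondegenerate_warpedProduct {gB : BilinField IB B} (hgB : IsSemiRiemannianMetric gB)
    {gF : BilinField IF F} (hgF : IsSemiRiemannianMetric gF) {f : B → ℝ} {p : B × F}
    (hp : f p.1 ≠ 0) : (warpedProduct gB gF f p).Nondegenerate := by
  have hsep : ∀ v : TangentSpace (IB.prod IF) p,
      (∀ w : TangentSpace (IB.prod IF) p, warpedProduct gB gF f p v w = 0) → v = 0 := by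
    intro v hv
    refine Prod.ext ((hgB.nondegenerate p.1).1 _ fun w => ?_)
      ((hgF.nondegenerate p.2).1 _ fun w => ?_)
    · have h := (warpedProduct_apply gB gF f p v ((w, 0) : EB × EF)).symm.trans (hv _)
      have h0 : gF p.2 v.2 (0 : TangentSpace IF p.2) = 0 := map_zero _
      have h1 : gB p.1 v.1 w + f p.1 ^ 2 * gF p.2 v.2 (0 : TangentSpace IF p.2) = 0 := h
      rwa [h0, mul_zero, add_zero] at h1
    · have h := (warpedProduct_apply gB gF f p v ((0, w) : EB × EF)).symm.trans (hv _)
      have h0 : gB p.1 v.1 (0 : TangentSpace IB p.1) = 0 := map_zero _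
      have h1 : gB p.1 v.1 (0 : TangentSpace IB p.1) + f p.1 ^ 2 * gF p.2 v.2 w = 0 := h
      rw [h0, zero_add] at h1
      exact (mul_eq_zero.1 h1).resolve_left (pow_ne_zero 2 hp)
  exact ⟨hsep, fun v hv => hsep v fun w => (warpedProduct_symm hgB hgF f p v w).trans (hv w)⟩

lemma base_ne_zero_of_nondegenerate_warpedProduct [Nontrivial EF] (gB : BilinField IB B)
    (gF : BilinField IF F) {f : B → ℝ} {p : B × F}
    (hnd : (warpedProduct gB gF f p).Nondegenerate) : f p.1 ≠ 0 := by
  intro h0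
  obtain ⟨v, hv⟩ := exists_ne (0 : EF)
  -- Where `f` vanishes, the vertical vector `(0, v)` is in the kernel.
  have h := hnd.1 ((0, v) : EB × EF) fun w => by
    refine (warpedProduct_apply gB gF f p ((0, v) : EB × EF) w).trans ?_
    have h1 : gB p.1 (0 : TangentSpace IB p.1) w.1 = 0 :=
      (congrArg (fun A => A w.1) (map_zero (gB p.1))).trans rfl
    have h2 : ∀ r : ℝ, gB p.1 (0 : TangentSpace IB p.1) w.1 + f p.1 ^ 2 * r = 0 := fun r => by
      rw [h1, h0]; ring
    exact h2 _
  exact hv (congrArg (fun z : EB × EF => z.2) h)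

lemma mem_target_chartParam [IB.Boundaryless] (b : B) :
    b ∈ (chartParam (I := IB) (chartAt HB b) (IsManifold.chart_mem_maximalAtlas b)).target :=
  ((chartAt HB b).extend_source (I := IB)).ge (mem_chart_source HB b)

lemma exists_param_of_finrank_eq_one [IB.Boundaryless] (hdim : Module.finrank ℝ EB = 1) (b : B) :
    ∃ ΨB : PartialDiffeomorph 𝓘(ℝ) IB ℝ B ∞, b ∈ ΨB.target := by
  let L : ℝ ≃L[ℝ] EB := ContinuousLinearEquiv.ofFinrankEq (by simp [hdim])
  refine ⟨L.toDiffeomorph.toPartialDiffeomorph.trans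
    (chartParam (chartAt HB b) (IsManifold.chart_mem_maximalAtlas b)), ?_⟩
  exact ⟨mem_target_chartParam b, trivial⟩

/-- A warped product with one-dimensional base is quasi-regular if its metric is degenerate wherever
the warping function vanishes, which is automatic for fibres of positive dimension. -/
lemma isQuasiRegular_warpedProduct_of_ne_zero [IB.Boundaryless] [IF.Boundaryless]
    {gB : BilinField IB B} (hgB : IsSemiRiemannianMetric gB) {gF : BilinField IF F}
    (hgF : IsSemiRiemannianMetric gF) (hdim : Module.finrank ℝ EB = 1) {f : B → ℝ}
    (hf : ContMDiff IB 𝓘(ℝ) ∞ f) (hf_dense : Dense {x : B | f x ≠ 0})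
    (hf0 : ∀ p : B × F, (warpedProduct gB gF f p).Nondegenerate → f p.1 ≠ 0) :
    IsQuasiRegular (warpedProduct gB gF f) := by
  refine isQuasiRegular_of_locally_warped (V := EF) (by rw [Module.finrank_prod, hdim])
    (warpedProduct_symm hgB hgF f) ?_ fun p => ?_
  · exact (hf_dense.preimage isOpenMap_fst).mono fun p hp => nondegenerate_warpedProduct hgB hgF hp
  · obtain ⟨ΨB, hB⟩ := exists_param_of_finrank_eq_one (IB := IB) hdim p.1
    let ΨF := chartParam (I := IF) (chartAt HF p.2) (IsManifold.chart_mem_maximalAtlas p.2)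
    exact ⟨prodParam ΨB ΨF, warpedModel hgB hgF hf ΨB ΨF, ⟨hB, mem_target_chartParam p.2⟩,
      isWarpedParam_prodParam hgB hgF hf hf0⟩

theorem isQuasiRegular_warpedProduct [IB.Boundaryless] [IF.Boundaryless]
    {gB : BilinField IB B} (hgB : IsSemiRiemannianMetric gB) {gF : BilinField IF F}
    (hgF : IsSemiRiemannianMetric gF) (hdim : Module.finrank ℝ EB = 1) {f : B → ℝ}
    (hf : ContMDiff IB 𝓘(ℝ) ∞ f) (hf_dense : Dense {x : B | f x ≠ 0}) :
    IsQuasiRegular (warpedProduct gB gF f) := by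
  rcases subsingleton_or_nontrivial EF with hs | hs
  · -- On a zero-dimensional fibre `f` does not enter the metric, so it may be replaced by `1`.
    have h : warpedProduct gB gF f = warpedProduct gB gF fun _ => 1 := by
      funext p
      refine LinearMap.ext fun v => LinearMap.ext fun w => ?_
      rw [warpedProduct_apply, warpedProduct_apply]
      have h0 : gF p.2 v.2 w.2 = 0 := by
        rw [show w.2 = (0 : TangentSpace IF p.2) from Subsingleton.elim (α := EF) _ _, map_zero]
      rw [h0, mul_zero, mul_zero]
    rw [h]
    exact isQuasiRegular_warpedProduct_of_ne_zero hgB hgF hdim contMDiff_const (by simp)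
      fun _ _ => one_ne_zero
  · exact isQuasiRegular_warpedProduct_of_ne_zero hgB hgF hdim hf hf_dense
      fun _ => base_ne_zero_of_nondegenerate_warpedProduct gB gF

end Product

end SingularSemiRiemannian

end

theorem mainTheorem2
    {EB : Type*} [NormedAddCommGroup EB] [NormedSpace ℝ EB] [FiniteDimensional ℝ EB]
    {HB : Type*} [TopologicalSpace HB] (IB : ModelWithCorners ℝ EB HB) [IB.Boundaryless]
    {B : Type*} [TopologicalSpace B] [ChartedSpace HB B] [IsManifold IB ∞ B]
    {EF : Type*} [NormedAddCommGroup EF] [NormedSpace ℝ EF] [FiniteDimensional ℝ EF]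
    {HF : Type*} [TopologicalSpace HF] (IF : ModelWithCorners ℝ EF HF) [IF.Boundaryless]
    {F : Type*} [TopologicalSpace F] [ChartedSpace HF F] [IsManifold IF ∞ F]
    (gB : SingularSemiRiemannian.BilinField IB B)
    (hgB : SingularSemiRiemannian.IsSemiRiemannianMetric gB)
    (gF : SingularSemiRiemannian.BilinField IF F)
    (hgF : SingularSemiRiemannian.IsSemiRiemannianMetric gF)
    (hdim : Module.finrank ℝ EB = 1)
    (f : B → ℝ) (hf : ContMDiff IB 𝓘(ℝ) ∞ f) (hf_dense : Dense {x : B | f x ≠ 0}) :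
    SingularSemiRiemannian.IsQuasiRegular
      (SingularSemiRiemannian.warpedProduct gB gF f) := by
  exact SingularSemiRiemannian.isQuasiRegular_warpedProduct hgB hgF hdim hf hf_dense
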